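/- Let $\Gamma$ be a finite, connected, non-bipartite distance-regular graph with vertex set $X$, diameter $D\ge 3$, intersection numbers $p^h_{ij}$, $c_i=p^i_{1,i-1}$, $a_i=p^i_{1i}$, $b_i=p^i_{1,i+1}$, and eigenvalues $\theta_0>\theta_1>\dots>\theta_D$. Assume that $\Gamma$ has classical parameters $(D,1,\alpha,\beta)$ with $\alpha,\beta\in\mathbb R$, i.e. $c_i=i(1+\alpha(i-1))$ for $1\le i\le D$ and $b_i=(D-i)(\beta-\alpha i)$ for $0\le i\le D-1$, and that $\Gamma$ is tight, i.e. $$\Big(\theta_1+\frac{b_0}{a_1+1}\Big)\Big(\theta_D+\frac{b_0}{a_1+1}\Big)=-\frac{b_0a_1b_1}{(a_1+1)^2}.$$ Fix $x\in X$ and let $\partial$ be the path-length distance in $\Gamma$. Let $\Gamma_f$ be the graph on $X$ obtained from $\Gamma$ by deleting all edges $yz$ with $\partial(x,y)=\partial(x,z)$. Let $V=\mathbb C^X$, let $A$ be the adjacency matrix of $\Gamma$, let $E_i^*$ be the diagonal matrix with $(y,y)$-entry $1$ if $\partial(x,y)=i$ and $0$ otherwise, and put $L=\sum_{i=1}^{D}E^*_{i-1}AE^*_i$,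 $F=\sum_{i=0}^{D}E^*_iAE^*_i$, $R=\sum_{i=0}^{D-1}E^*_{i+1}AE^*_i$. Let $T$ be the algebra of complex matrices generated by $A,E_0^*,\dots,E_D^*$, and let $T_f$ be the algebra defined in the same way from $\Gamma_f$; it is generated by $L,R,E_0^*,\dots,E_D^*$. A $T$-module is a $T$-invariant subspace $W$ of $V$; it is irreducible if it is nonzero and contains no $T$-modules other than $0$ and $W$, its endpoint is $r=\min\{i: E_i^*W\ne0\}$, and it is thin if $\dim E_i^*W\le1$ for all $i$. A thin irreducible $T$-module has local eigenvalue $\eta$ if $F$ acts on $E_r^*W$ as $\eta$. For a real number $z\neq-1$ put $\tilde z=-1-b_1/(1+z)$; it is known that $\theta_1,\theta_D\neq-1$. (i) $\Gamma$ does not support a uniform structure with respect to $x$. That is, there are no tridiagonal complex matrix $U=(e_{ij})_{1\le i,j\le D}$ and no $f\in\mathbb C^D$ such that: $e_{ii}=1$ for all $i$; either $e_{i,i-1}\ne0$ for all $2\le i\le D$, or $e_{i-1,i}\neq0$ for all $2\le i\le D$; every principal submatrix $(e_{ij})_{s\le i,j\le t}$ with $1\le s\le t\le D$ is nonsingular;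 and, with $e_i^-=e_{i,i-1}$ for $2\le i\le D$, $e_i^+=e_{i,i+1}$ for $1\le i\le D-1$, $e_1^-=e_D^+=0$, $$e_i^-RL^2+LRL+e_i^+L^2R=f_iL\quad\text{on }E_i^*V\qquad(1\le i\le D).$$ (ii) There are irreducible $T$-modules $W$ and $W'$ with endpoint $1$, both thin, with local eigenvalues $\tilde\theta_1$ and $\tilde\theta_D$ respectively, such that every irreducible $T$-module with endpoint $1$ is isomorphic to $W$ or to $W'$ as a $T$-module, and $W$ and $W'$ are not isomorphic as $T_f$-modules. -/

import Mathlib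

namespace SimpleGraph

variable {X : Type*} [Fintype X] [DecidableEq X]

/-! ### Distance-regular graphs, classical parameters, tightness -/

/-- `G` is a (finite, connected) distance-regular graph with intersection numbers `p h i j`:
for all `h, i, j` in `{0, …, diam G}` and all vertices `y, z` at distance `h`, there are exactly
`p h i j` vertices at distance `i` from `y` and at distance `j` from `z`.
(The values of `p` outside this range are irrelevant.) -/
def IsDistanceRegularWith (G : SimpleGraph X) (p : ℕ → ℕ → ℕ → ℕ) : Prop :=
  G.Connected ∧ ∀ h i j : ℕ, h ≤ G.diam → i ≤ G.diam → j ≤ G.diam →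
    ∀ y z : X, G.dist y z = h →
      (Finset.univ.filter fun u : X => G.dist y u = i ∧ G.dist z u = j).card = p h i j

/-- The number `[j choose 1]_q = 1 + q + ⋯ + q ^ (j - 1)`. -/
noncomputable def qBracket (q : ℝ) (j : ℕ) : ℝ := ∑ l ∈ Finset.range j, q ^ l

/-- A distance-regular graph `G` with intersection numbers `p` has classical parameters
`(D, q, α, β)`; here `c i = p i 1 (i - 1)` and `b i = p i 1 (i + 1)`. -/
def HasClassicalParameters (G : SimpleGraph X) (p : ℕ → ℕ → ℕ → ℕ)
    (D : ℕ) (q α β : ℝ) : Prop :=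
  G.diam = D ∧
  (∀ i : ℕ, 1 ≤ i → i ≤ D →
    (p i 1 (i - 1) : ℝ) = qBracket q i * (1 + α * qBracket q (i - 1))) ∧
  (∀ i : ℕ, i < D →
    (p i 1 (i + 1) : ℝ) = (qBracket q D - qBracket q i) * (β - α * qBracket q i))

open scoped Classical in
/-- The set of eigenvalues of `G` (those of its adjacency matrix, which is real symmetric). -/
noncomputable def eigenvalueSet (G : SimpleGraph X) : Set ℝ := spectrum ℝ (G.adjMatrix ℝ)

/-- The second largest eigenvalue `θ₁`: the largest of the eigenvalues that are exceeded by some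
other eigenvalue. -/
noncomputable def secondEigenvalue (G : SimpleGraph X) : ℝ :=
  sSup {t | t ∈ G.eigenvalueSet ∧ ∃ s ∈ G.eigenvalueSet, t < s}

/-- The least eigenvalue, which is `θ_D` for a distance-regular graph of diameter `D`. -/
noncomputable def leastEigenvalue (G : SimpleGraph X) : ℝ := sInf G.eigenvalueSet

/-- A distance-regular graph `G` with intersection numbers `p` is tight when equality holds in the
fundamental bound; here `b₀ = p 0 1 1`, `a₁ = p 1 1 1`, `b₁ = p 1 1 2`. -/
def IsTight (G : SimpleGraph X) (p : ℕ → ℕ → ℕ → ℕ) : Prop :=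
  (G.secondEigenvalue + (p 0 1 1 : ℝ) / ((p 1 1 1 : ℝ) + 1)) *
      (G.leastEigenvalue + (p 0 1 1 : ℝ) / ((p 1 1 1 : ℝ) + 1)) =
    -((p 0 1 1 : ℝ) * (p 1 1 1 : ℝ) * (p 1 1 2 : ℝ)) / ((p 1 1 1 : ℝ) + 1) ^ 2

/-- The number `z̃ = -1 - b₁ / (1 + z)`, for `z ≠ -1`. It is used only for `z = θ₁` and `z = θ_D`,
which are different from `-1` in every distance-regular graph of diameter at least three. -/
noncomputable def tildeValue (p : ℕ → ℕ → ℕ → ℕ) (z : ℝ) : ℝ := -1 - (p 1 1 2 : ℝ) / (1 + z)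

/-! ### Dual idempotents, lowering, flat and raising matrices -/

/-- The eccentricity of the vertex `x` (for a finite connected graph). -/
noncomputable def vertexEcc (G : SimpleGraph X) (x : X) : ℕ :=
  Finset.univ.sup fun y : X => G.dist x y

open scoped Classical in
/-- The adjacency matrix with complex entries. -/
noncomputable def cAdj (G : SimpleGraph X) : Matrix X X ℂ := G.adjMatrix ℂ

/-- The `i`-th dual idempotent `E*_i` with respect to `x`
(the zero matrix if `i` exceeds the eccentricity of `x`). -/
noncomputable def dualIdempotent (G : SimpleGraph X) (x : X) (i : ℕ) : Matrix X X ℂ :=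
  Matrix.diagonal fun y => if G.dist x y = i then 1 else 0

/-- The lowering matrix with respect to `x`. -/
noncomputable def lowering (G : SimpleGraph X) (x : X) : Matrix X X ℂ :=
  ∑ i ∈ Finset.Icc 1 (G.vertexEcc x),
    G.dualIdempotent x (i - 1) * G.cAdj * G.dualIdempotent x i

/-- The flat matrix with respect to `x`. -/
noncomputable def flat (G : SimpleGraph X) (x : X) : Matrix X X ℂ :=
  ∑ i ∈ Finset.range (G.vertexEcc x + 1),
    G.dualIdempotent x i * G.cAdj * G.dualIdempotent x i

/-- The raising matrix with respect to `x`. -/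
noncomputable def raising (G : SimpleGraph X) (x : X) : Matrix X X ℂ :=
  ∑ i ∈ Finset.range (G.vertexEcc x),
    G.dualIdempotent x (i + 1) * G.cAdj * G.dualIdempotent x i

/-! ### Uniform structures -/

/-- `(U i j)`, `1 ≤ i, j ≤ ε`, is a parameter matrix. Only entries with indices in `{1, …, ε}`
are relevant. -/
structure IsParameterMatrix (ε : ℕ) (U : ℕ → ℕ → ℂ) : Prop where
  tridiagonal : ∀ i ∈ Finset.Icc 1 ε, ∀ j ∈ Finset.Icc 1 ε, (i + 1 < j ∨ j + 1 < i) → U i j = 0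
  diagonal : ∀ i ∈ Finset.Icc 1 ε, U i i = 1
  offDiagonal : (∀ i ∈ Finset.Icc 2 ε, U i (i - 1) ≠ 0) ∨ (∀ i ∈ Finset.Icc 2 ε, U (i - 1) i ≠ 0)
  nonsingular : ∀ s t : ℕ, 1 ≤ s → s ≤ t → t ≤ ε →
    (Matrix.of fun i j : Finset.Icc s t => U i j).det ≠ 0

/-- `e⁻_i = U i (i - 1)` for `2 ≤ i`, and `e⁻_1 = 0`. -/
noncomputable def eMinus (U : ℕ → ℕ → ℂ) (i : ℕ) : ℂ := if 2 ≤ i then U i (i - 1) else 0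

/-- `e⁺_i = U i (i + 1)` for `i < ε`, and `e⁺_ε = 0`. -/
noncomputable def ePlus (ε : ℕ) (U : ℕ → ℕ → ℂ) (i : ℕ) : ℂ := if i < ε then U i (i + 1) else 0

/-- `(U, f)` is a uniform structure of the bipartite graph `H` with respect to `x`: the matrix `U`
is a parameter matrix and `e⁻_i R L² + L R L + e⁺_i L² R = f_i L` holds on `E*_i V` for
`1 ≤ i ≤ ε`. An identity of matrices holds on `E*_i V` exactly when it holds after
multiplication by `E*_i` on the right. -/
def IsUniformStructure (H : SimpleGraph X) (x : X) (U : ℕ → ℕ → ℂ) (f : ℕ → ℂ) : Prop :=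
  IsParameterMatrix (H.vertexEcc x) U ∧
  ∀ i ∈ Finset.Icc 1 (H.vertexEcc x),
    (eMinus U i • (H.raising x * H.lowering x ^ 2)
        + H.lowering x * H.raising x * H.lowering x
        + ePlus (H.vertexEcc x) U i • (H.lowering x ^ 2 * H.raising x)) * H.dualIdempotent x i
      = (f i • H.lowering x) * H.dualIdempotent x i

/-- The graph `G_f` obtained from `G` by deleting all edges between vertices that are at the same
distance from `x`. -/
def flatFree (G : SimpleGraph X) (x : X) : SimpleGraph X where
  Adj y z := G.Adj y z ∧ G.dist x y ≠ G.dist x z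
  symm := ⟨fun _ _ h => ⟨h.1.symm, h.2.symm⟩⟩
  loopless := ⟨fun _ h => h.2 rfl⟩

/-- `G` supports a uniform structure with respect to `x`: the (bipartite) graph `G_f` admits one. -/
def SupportsUniformStructure (G : SimpleGraph X) (x : X) : Prop :=
  ∃ (U : ℕ → ℕ → ℂ) (f : ℕ → ℂ), (G.flatFree x).IsUniformStructure x U f

/-! ### The Terwilliger algebra and its modules -/

/-- The Terwilliger algebra `T(x)`, generated by the adjacency matrix and the dual idempotents.
The Terwilliger algebra `T_f` is the one of the graph `G_f`. -/
noncomputable def terwilligerAlgebra (G : SimpleGraph X) (x : X) : Subalgebra ℂ (Matrix X X ℂ) :=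
  Algebra.adjoin ℂ (insert G.cAdj (Set.range (G.dualIdempotent x)))

/-- A `T`-module is a subspace of the standard module that is invariant under `T`. -/
def IsTModule (T : Subalgebra ℂ (Matrix X X ℂ)) (W : Submodule ℂ (X → ℂ)) : Prop :=
  ∀ B ∈ T, ∀ w ∈ W, B.mulVec w ∈ W

/-- Irreducible `T`-modules. -/
def IsIrreducibleTModule (T : Subalgebra ℂ (Matrix X X ℂ)) (W : Submodule ℂ (X → ℂ)) : Prop :=
  IsTModule T W ∧ W ≠ ⊥ ∧ ∀ W' ≤ W, IsTModule T W' → W' = ⊥ ∨ W' = W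

/-- `W` and `W'` are isomorphic as `T`-modules: there is a linear bijection `σ : W → W'` with
`σ (B w) = B (σ w)` for all `B ∈ T` and `w ∈ W`. -/
def AreTIsomorphic (T : Subalgebra ℂ (Matrix X X ℂ)) (W W' : Submodule ℂ (X → ℂ)) : Prop :=
  ∃ σ : W ≃ₗ[ℂ] W', ∀ B ∈ T, ∀ w u : W,
    (u : X → ℂ) = B.mulVec (w : X → ℂ) → (σ u : X → ℂ) = B.mulVec (σ w : X → ℂ)

/-- The subspace `E*_i W`. -/
noncomputable def dualComponent (G : SimpleGraph X) (x : X) (i : ℕ) (W : Submodule ℂ (X → ℂ)) :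
    Submodule ℂ (X → ℂ) :=
  W.map (G.dualIdempotent x i).mulVecLin

/-- The endpoint of a nonzero `T`-module `W`: the least `i` with `E*_i W ≠ 0`. -/
noncomputable def endpoint (G : SimpleGraph X) (x : X) (W : Submodule ℂ (X → ℂ)) : ℕ :=
  sInf {i : ℕ | G.dualComponent x i W ≠ ⊥}

/-- `W` is thin: each `E*_i W` has dimension at most one. -/
def IsThin (G : SimpleGraph X) (x : X) (W : Submodule ℂ (X → ℂ)) : Prop :=
  ∀ i : ℕ, Module.finrank ℂ (G.dualComponent x i W) ≤ 1

/-- The thin module `W`, of endpoint `r`, has local eigenvalue `η`: the flat matrix acts on the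
line `E*_r W` as multiplication by `η`. -/
def HasLocalEigenvalue (G : SimpleGraph X) (x : X) (W : Submodule ℂ (X → ℂ)) (η : ℝ) : Prop :=
  G.IsThin x W ∧
  ∀ w ∈ G.dualComponent x (G.endpoint x W) W, (G.flat x).mulVec w = (η : ℂ) • w

end SimpleGraph

/-! For base 1 the adjacency matrix `A` is bidiagonal in the basis of binomials in the distance,
with diagonal entries θ_j = (D - j)(β - αj) - j. This makes θ_1 and θ_D = -D explicit
(`eq_theta_of_mem`). Tightness then reads β = 1 + α(D - 1) (`beta_eq_of_tight`), and α = 0 would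
make the graph bipartite, so α > 0.

Let M and M' be the distance matrices of eigenvector sequences for θ_1 and θ_D, in either order, and
let E project onto sum-zero functions on the neighbourhood of x. At this β the trace of E M E M'
vanishes, and a positivity argument gives M E M' = 0. For v local (sum zero, supported on the
neighbourhood), E M' v is a nonzero multiple of (A_loc - η)v, with A_loc the local adjacency and η a
constant read from M'. Hence M kills (A_loc - η)v (`cDistMatrix_mulVec_localShift`).

Suppose M v = 0 for such a v, and let A_i be the distance-i matrix. On the sphere of radius i + 1
only A_i v, A_{i+1} v and A_{i+2} v can be nonzero. They sum to zero and satisfy a second relation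
from M v = 0, so all are multiples of one vector w_{i+1}. The three-term recurrence for the A_i
makes A tridiagonal on w_1, ..., w_{D-1} (`isLadder`), with coefficients that depend only on which
matrix kills v. Such a ladder spans a thin irreducible module, determined up to isomorphism by its
coefficients. Every irreducible module of endpoint 1 contains a local vector, hence a ladder of one
of the two kinds.

Both negative claims compare the products φ_r = up_{r-1} down_r. A uniform structure imposes on φ_2,
..., φ_{D-1} a linear system with nonsingular tridiagonal matrix, so it forces the same φ for both
ladders. A `T_f`-isomorphism preserves φ_2, the eigenvalue of lowering after raising on the first
sphere. But the two values of φ_2 differ by (D - 2)α(2 + α(D - 2)) > 0 (`coeff_ne`). -/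

namespace SimpleGraph

set_option linter.unusedSectionVars false

open scoped Classical

variable {X : Type*} [Fintype X] [DecidableEq X]

/-! ### Neighbour counts -/

/-- For vertices `y, z` at distance `i`, exactly `c i`, `a i`, `b i` neighbours of `y` are at
distance `i - 1`, `i`, `i + 1` from `z`. -/
structure NeighborCounts (G : SimpleGraph X) (c a b : ℕ → ℕ) : Prop where
  connected : G.Connected
  card_c : ∀ y z, (Finset.univ.filter fun w => G.Adj y w ∧ G.dist w z + 1 = G.dist y z).card =
    c (G.dist y z)
  card_a : ∀ y z, (Finset.univ.filter fun w => G.Adj y w ∧ G.dist w z = G.dist y z).card =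
    a (G.dist y z)
  card_b : ∀ y z, (Finset.univ.filter fun w => G.Adj y w ∧ G.dist w z = G.dist y z + 1).card =
    b (G.dist y z)

theorem dist_le_diam_of_connected {G : SimpleGraph X} (h : G.Connected) (y z : X) :
    G.dist y z ≤ G.diam := by
  have := h.nonempty
  exact dist_le_diam (connected_iff_ediam_ne_top.1 h)

theorem Adj.dist_bounds {G : SimpleGraph X} (hc : G.Connected) {y w : X} (h : G.Adj y w) (z : X) :
    G.dist y z ≤ G.dist w z + 1 ∧ G.dist w z ≤ G.dist y z + 1 := by
  have h1 : G.dist y w = 1 := dist_eq_one_iff_adj.2 h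
  have h2 : G.dist w y = 1 := dist_eq_one_iff_adj.2 h.symm
  have := hc.dist_triangle (u := y) (v := w) (w := z)
  have := hc.dist_triangle (u := w) (v := y) (w := z)
  omega

/-- The guards settle the ends of the array: `p` is unconstrained beyond the diameter, so `b` must
be set to zero there, and at `i = 0` the truncated `i - 1` would not mean distance -1. -/
theorem IsDistanceRegularWith.neighborCounts {G : SimpleGraph X} {p : ℕ → ℕ → ℕ → ℕ}
    (h : G.IsDistanceRegularWith p) (hD : 1 ≤ G.diam) :
    G.NeighborCounts (fun i => if i = 0 then 0 else p i 1 (i - 1)) (fun i => p i 1 i)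
      (fun i => if i < G.diam then p i 1 (i + 1) else 0) := by
  obtain ⟨hc, h⟩ := h
  have key : ∀ y z j, j ≤ G.diam →
      (Finset.univ.filter fun w => G.Adj y w ∧ G.dist w z = j).card = p (G.dist y z) 1 j := by
    intro y z j hj
    rw [← h _ 1 j (dist_le_diam_of_connected hc y z) hD hj y z rfl]
    congr 1
    ext w
    simp only [Finset.mem_filter, Finset.mem_univ, true_and, dist_eq_one_iff_adj,
      G.dist_comm (u := z)]
  refine ⟨hc, ?_, ?_, ?_⟩
  · intro y z
    have := dist_le_diam_of_connected hc y z
    split_ifs with h0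
    · simp [h0]
    · rw [← key y z _ (by omega)]
      congr 1
      ext w
      simp only [Finset.mem_filter, Finset.mem_univ, true_and]
      constructor <;> rintro ⟨h1, h2⟩ <;> exact ⟨h1, by omega⟩
  · intro y z
    exact key y z _ (dist_le_diam_of_connected hc y z)
  · intro y z
    split_ifs with h0
    · exact key y z _ (by omega)
    · rw [Finset.card_eq_zero, Finset.filter_eq_empty_iff]
      rintro w - ⟨-, h2⟩
      have := dist_le_diam_of_connected hc w z
      omega

namespace NeighborCounts

variable {G : SimpleGraph X} {c a b : ℕ → ℕ}

theorem c_zero (h : G.NeighborCounts c a b) : c 0 = 0 := by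
  have := h.connected.nonempty
  have y : X := Classical.arbitrary X
  have := h.card_c y y
  simpa using this.symm

theorem a_zero (h : G.NeighborCounts c a b) : a 0 = 0 := by
  have := h.connected.nonempty
  have y : X := Classical.arbitrary X
  have := h.card_a y y
  rw [dist_self] at this
  rw [← this, Finset.card_eq_zero, Finset.filter_eq_empty_iff]
  rintro w - ⟨h1, h2⟩
  exact h1.ne (h.connected.dist_eq_zero_iff.1 h2).symm

/-- Moving to a neighbour changes the distance to `z` by at most one. The truncated subtraction at
distance 0 is harmless because `c 0 = 0`. -/
theorem sum_adj (h : G.NeighborCounts c a b) {R : Type*} [CommRing R] (f : ℕ → R) (y z : X) :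
    ∑ w ∈ G.neighborFinset y, f (G.dist w z) =
      c (G.dist y z) * f (G.dist y z - 1) + a (G.dist y z) * f (G.dist y z) +
        b (G.dist y z) * f (G.dist y z + 1) := by
  rw [← h.card_c, ← h.card_a, ← h.card_b]
  simp only [Finset.card_filter, Nat.cast_sum, Finset.sum_mul, ← Finset.sum_add_distrib]
  have hn : G.neighborFinset y = Finset.univ.filter (fun w => G.Adj y w) := by
    ext; simp
  rw [hn, Finset.sum_filter]
  refine Finset.sum_congr rfl fun w _ => ?_
  by_cases hw : G.Adj y w
  · obtain ⟨h1, h2⟩ := hw.dist_bounds h.connected z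
    simp only [hw, if_true, true_and]
    rcases (by omega : G.dist w z + 1 = G.dist y z ∨ G.dist w z = G.dist y z ∨
      G.dist w z = G.dist y z + 1) with h3 | h3 | h3
    · rw [← h3]; simp [show ¬ (G.dist w z = G.dist w z + 1 + 1) by omega]
    · rw [← h3]; simp
    · rw [h3]; simp [show ¬ (G.dist y z + 1 + 1 = G.dist y z) by omega]
  · simp [hw]

theorem card_neighborFinset (h : G.NeighborCounts c a b) (y z : X) :
    (G.neighborFinset y).card = c (G.dist y z) + a (G.dist y z) + b (G.dist y z) := by
  have := h.sum_adj (R := ℤ) (fun _ => 1) y z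
  simp only [Finset.sum_const, mul_one, nsmul_eq_mul] at this
  exact_mod_cast this

theorem card_neighborFinset_eq (h : G.NeighborCounts c a b) (y : X) :
    (G.neighborFinset y).card = b 0 := by
  simpa [h.c_zero, h.a_zero] using h.card_neighborFinset y y

theorem sum_eq_degree (h : G.NeighborCounts c a b) (y z : X) :
    c (G.dist y z) + a (G.dist y z) + b (G.dist y z) = b 0 := by
  rw [← h.card_neighborFinset y z, h.card_neighborFinset_eq]

theorem c_pos_of_exists (h : G.NeighborCounts c a b) {y z w : X} (hw : G.Adj y w)
    (hd : G.dist w z + 1 = G.dist y z) : 0 < c (G.dist y z) := by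
  rw [← h.card_c, Finset.card_pos]
  exact ⟨w, by simp [hw, hd]⟩

theorem b_pos_of_exists (h : G.NeighborCounts c a b) {y z w : X} (hw : G.Adj y w)
    (hd : G.dist w z = G.dist y z + 1) : 0 < b (G.dist y z) := by
  rw [← h.card_b, Finset.card_pos]
  exact ⟨w, by simp [hw, hd]⟩

end NeighborCounts

theorem Connected.exists_adj_dist_add_one {G : SimpleGraph X} (h : G.Connected) {y z : X}
    (hyz : y ≠ z) : ∃ w, G.Adj y w ∧ G.dist w z + 1 = G.dist y z := by
  obtain ⟨q, hq⟩ := h.exists_walk_length_eq_dist y z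
  cases q with
  | nil => exact absurd rfl hyz
  | cons hadj q =>
    rename_i w
    refine ⟨w, hadj, ?_⟩
    have h1 := dist_le q
    have h2 := (hadj.dist_bounds h z).1
    simp only [Walk.length_cons] at hq
    omega

theorem Connected.exists_dist_eq_of_le {G : SimpleGraph X} (h : G.Connected) {y z : X} {i : ℕ}
    (hi : i ≤ G.dist y z) : ∃ w, G.dist w z = i := by
  obtain ⟨n, hn⟩ : ∃ n, G.dist y z = i + n := ⟨_, (Nat.add_sub_of_le hi).symm⟩
  induction n generalizing y with
  | zero => exact ⟨y, hn⟩
  | succ n ih =>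
    have hyz : y ≠ z := by
      rintro rfl
      rw [dist_self] at hn
      omega
    obtain ⟨w, -, hw⟩ := h.exists_adj_dist_add_one hyz
    exact ih (y := w) (by omega) (by omega)

theorem exists_dist_pair {G : SimpleGraph X} (h : G.Connected) {i : ℕ} (hi : i ≤ G.diam) :
    ∃ y z, G.dist y z = i := by
  have := h.nonempty
  obtain ⟨u, v, huv⟩ := G.exists_dist_eq_diam
  obtain ⟨w, hw⟩ := h.exists_dist_eq_of_le (huv ▸ hi)
  exact ⟨w, v, hw⟩

namespace NeighborCounts

variable {G : SimpleGraph X} {c a b : ℕ → ℕ}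

theorem c_pos (h : G.NeighborCounts c a b) {i : ℕ} (h0 : 1 ≤ i) (hi : i ≤ G.diam) : 0 < c i := by
  obtain ⟨y, z, rfl⟩ := exists_dist_pair h.connected hi
  have hyz : y ≠ z := by
    rintro rfl
    simp at h0
  obtain ⟨w, h1, h2⟩ := h.connected.exists_adj_dist_add_one hyz
  exact h.c_pos_of_exists h1 h2

theorem b_pos (h : G.NeighborCounts c a b) {i : ℕ} (hi : i < G.diam) : 0 < b i := by
  obtain ⟨y, z, hyz⟩ := exists_dist_pair h.connected (Nat.succ_le_of_lt hi)
  have hne : y ≠ z := by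
    rintro rfl
    simp at hyz
  obtain ⟨w, h1, h2⟩ := h.connected.exists_adj_dist_add_one hne
  have h3 : G.dist w z = i := by omega
  rw [← h3]
  exact h.b_pos_of_exists h1.symm h2.symm

theorem sum_eq_b_zero (h : G.NeighborCounts c a b) {i : ℕ} (hi : i ≤ G.diam) :
    c i + a i + b i = b 0 := by
  obtain ⟨y, z, rfl⟩ := exists_dist_pair h.connected hi
  exact h.sum_eq_degree y z

/-- Since b_i > 0 below the diameter, one can step outwards from any vertex; this is why every
vertex has eccentricity equal to the diameter. -/
theorem exists_dist_eq (h : G.NeighborCounts c a b) (x : X) {i : ℕ} (hi : i ≤ G.diam) :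
    ∃ y, G.dist x y = i := by
  induction i with
  | zero => exact ⟨x, dist_self⟩
  | succ i ih =>
    obtain ⟨y, hy⟩ := ih (by omega)
    have := h.b_pos (i := i) (by omega)
    rw [← hy, G.dist_comm, ← h.card_b, Finset.card_pos] at this
    obtain ⟨w, hw⟩ := this
    simp only [Finset.mem_filter, Finset.mem_univ, true_and] at hw
    exact ⟨w, by rw [G.dist_comm, hw.2, G.dist_comm, hy]⟩

theorem vertexEcc_eq (h : G.NeighborCounts c a b) (x : X) : G.vertexEcc x = G.diam := by
  refine le_antisymm (Finset.sup_le fun y _ => dist_le_diam_of_connected h.connected x y) ?_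
  obtain ⟨y, hy⟩ := h.exists_dist_eq x le_rfl
  rw [← hy]
  exact Finset.le_sup (f := fun y => G.dist x y) (Finset.mem_univ y)

end NeighborCounts

/-! ### Matrices whose entries depend on the distance -/

/-- The matrix with `(y, z)`-entry `u (dist y z)`. -/
noncomputable def distMatrix (G : SimpleGraph X) {R : Type*} (u : ℕ → R) : Matrix X X R :=
  Matrix.of fun y z => u (G.dist y z)

section

variable {G : SimpleGraph X} {R : Type*}

@[simp] theorem distMatrix_apply (u : ℕ → R) (y z : X) : G.distMatrix u y z = u (G.dist y z) := rfl

theorem transpose_distMatrix (u : ℕ → R) : (G.distMatrix u).transpose = G.distMatrix u := by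
  ext y z
  simp [G.dist_comm (u := y)]

theorem distMatrix_congr (h : G.Connected) {u u' : ℕ → R} (hu : ∀ i ≤ G.diam, u i = u' i) :
    G.distMatrix u = G.distMatrix u' := by
  ext y z
  exact hu _ (dist_le_diam_of_connected h y z)

theorem distMatrix_add [Add R] (u u' : ℕ → R) :
    G.distMatrix (u + u') = G.distMatrix u + G.distMatrix u' := rfl

theorem distMatrix_smul [Mul R] (r : R) (u : ℕ → R) :
    G.distMatrix (r • u) = r • G.distMatrix u := rfl

theorem distMatrix_single_zero [CommRing R] (h : G.Connected) :
    G.distMatrix (Pi.single 0 (1 : R)) = 1 := by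
  ext y z
  simp [Matrix.one_apply, Pi.single_apply, h.dist_eq_zero_iff]

end

/-- The action of the intersection array on functions of the distance. -/
def arrayStep {R : Type*} [CommRing R] (c a b : ℕ → ℕ) (u : ℕ → R) : ℕ → R :=
  fun i => c i * u (i - 1) + a i * u i + b i * u (i + 1)

namespace NeighborCounts

variable {G : SimpleGraph X} {c a b : ℕ → ℕ} {R : Type*} [CommRing R]

theorem adjMatrix_mul_distMatrix (h : G.NeighborCounts c a b) (u : ℕ → R) :
    G.adjMatrix R * G.distMatrix u = G.distMatrix (arrayStep c a b u) := by
  ext y z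
  rw [adjMatrix_mul_apply]
  exact h.sum_adj u y z

theorem distMatrix_mul_adjMatrix (h : G.NeighborCounts c a b) (u : ℕ → R) :
    G.distMatrix u * G.adjMatrix R = G.distMatrix (arrayStep c a b u) := by
  rw [← transpose_distMatrix (arrayStep c a b u), ← h.adjMatrix_mul_distMatrix,
    Matrix.transpose_mul, transpose_distMatrix, transpose_adjMatrix]

theorem arrayStep_single_zero (h : G.NeighborCounts c a b) (i : ℕ) :
    arrayStep c a b (Pi.single 0 (1 : R)) i = (c 1 : R) * Pi.single (M := fun _ => R) 1 1 i := by
  rcases i with _ | _ | i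
  · simp [arrayStep, h.c_zero, h.a_zero]
  · simp [arrayStep]
  · simp [arrayStep]

theorem _root_.SimpleGraph.arrayStep_single_succ (j i : ℕ) :
    arrayStep c a b (Pi.single (j + 1) (1 : R)) i =
      b j * Pi.single (M := fun _ => R) j 1 i + a (j + 1) * Pi.single (M := fun _ => R) (j + 1) 1 i
        + c (j + 2) * Pi.single (M := fun _ => R) (j + 2) 1 i := by
  simp only [arrayStep, Pi.single_apply]
  have e1 : (i - 1 = j + 1) ↔ i = j + 2 := by omega
  have e2 : (i + 1 = j + 1) ↔ i = j := by omega
  rw [if_congr e1 rfl rfl, if_congr e2 rfl rfl]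
  split_ifs <;> subst_vars <;> first | omega | ring

theorem adjMatrix_mul_sphere_zero (h : G.NeighborCounts c a b) :
    G.adjMatrix R * G.distMatrix (Pi.single 0 1) = (c 1 : R) • G.distMatrix (Pi.single 1 1) := by
  rw [h.adjMatrix_mul_distMatrix, ← distMatrix_smul]
  congr 1
  ext i
  exact h.arrayStep_single_zero i

theorem adjMatrix_mul_sphere_succ (h : G.NeighborCounts c a b) (j : ℕ) :
    G.adjMatrix R * G.distMatrix (Pi.single (j + 1) 1) =
      (b j : R) • G.distMatrix (Pi.single j 1) +
        (a (j + 1) : R) • G.distMatrix (Pi.single (j + 1) 1) +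
          (c (j + 2) : R) • G.distMatrix (Pi.single (j + 2) 1) := by
  rw [h.adjMatrix_mul_distMatrix, ← distMatrix_smul, ← distMatrix_smul, ← distMatrix_smul,
    ← distMatrix_add, ← distMatrix_add]
  congr 1
  ext i
  exact arrayStep_single_succ j i

/-- The adjacency matrix acts on `distMatrix u` as θ, and the three-term recurrence can be solved
for the next sphere matrix since c is nonzero up to the diameter. Beyond the diameter sphere
matrices vanish. The induction carries two consecutive indices. -/
theorem sphere_mul_distMatrix {K : Type*} [Field K] [CharZero K] (h : G.NeighborCounts c a b)
    {u : ℕ → K} {θ : K} (hu : ∀ i ≤ G.diam, arrayStep c a b u i = θ * u i) (i : ℕ) :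
    ∃ l : K, G.distMatrix (Pi.single i 1) * G.distMatrix u = l • G.distMatrix u := by
  have hA : G.adjMatrix K * G.distMatrix u = θ • G.distMatrix u := by
    rw [h.adjMatrix_mul_distMatrix, ← distMatrix_smul]
    exact distMatrix_congr h.connected hu
  have big : ∀ j, G.diam < j → G.distMatrix (Pi.single j (1 : K)) = 0 := by
    intro j hj
    rw [distMatrix_congr (u' := 0) h.connected]
    · rfl
    · intro i hi
      simp [show i ≠ j by omega]
  suffices H : ∀ i, (∃ l : K, G.distMatrix (Pi.single i 1) * G.distMatrix u = l • G.distMatrix u) ∧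
      (∃ l : K, G.distMatrix (Pi.single (i + 1) 1) * G.distMatrix u = l • G.distMatrix u) from
    (H i).1
  intro i
  induction i with
  | zero =>
    refine ⟨⟨1, by simp [distMatrix_single_zero h.connected]⟩, ?_⟩
    by_cases hd : 1 ≤ G.diam
    · refine ⟨θ / c 1, ?_⟩
      have h1 := congrArg (· * G.distMatrix u) (h.adjMatrix_mul_sphere_zero (R := K))
      simp only [distMatrix_single_zero h.connected, mul_one, hA, Matrix.smul_mul] at h1
      have hc : (c 1 : K) ≠ 0 := by exact_mod_cast (h.c_pos le_rfl hd).ne'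
      rw [div_eq_inv_mul, mul_smul, h1, smul_smul, inv_mul_cancel₀ hc, one_smul]
    · exact ⟨0, by rw [big _ (by omega)]; simp⟩
  | succ i ih =>
    obtain ⟨⟨l, hl⟩, ⟨l', hl'⟩⟩ := ih
    refine ⟨⟨l', hl'⟩, ?_⟩
    by_cases hd : i + 2 ≤ G.diam
    · refine ⟨(l' * θ - b i * l - a (i + 1) * l') / c (i + 2), ?_⟩
      have h1 := congrArg (· * G.distMatrix u) (h.adjMatrix_mul_sphere_succ (R := K) i)
      have hc : (c (i + 2) : K) ≠ 0 := by exact_mod_cast (h.c_pos (by omega) hd).ne'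
      simp only [Matrix.mul_assoc, Matrix.add_mul, Matrix.smul_mul, hl, hl', Matrix.mul_smul,
        hA] at h1
      rw [div_eq_inv_mul, mul_smul]
      apply (inv_smul_eq_iff₀ hc).2 _ |>.symm
      linear_combination (norm := module) h1
    · exact ⟨0, by rw [big _ (by omega)]; simp⟩

theorem distMatrix_mul_self {K : Type*} [Field K] [CharZero K] (h : G.NeighborCounts c a b)
    {u : ℕ → K} {θ : K} (hu : ∀ i ≤ G.diam, arrayStep c a b u i = θ * u i) :
    ∃ l : K, G.distMatrix u * G.distMatrix u = l • G.distMatrix u := by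
  choose l hl using h.sphere_mul_distMatrix hu
  have e : G.distMatrix u =
      ∑ i ∈ Finset.range (G.diam + 1), u i • G.distMatrix (Pi.single i (1 : K)) := by
    ext y z
    have := dist_le_diam_of_connected h.connected y z
    simp [Matrix.sum_apply, Pi.single_apply]
    omega
  refine ⟨∑ i ∈ Finset.range (G.diam + 1), u i * l i, ?_⟩
  conv_lhs => lhs; rw [e]
  rw [Finset.sum_mul, Finset.sum_smul]
  refine Finset.sum_congr rfl fun i _ => ?_
  rw [Matrix.smul_mul, hl, smul_smul]

end NeighborCounts

/-! ### The spectrum of a graph with classical parameters `(D, 1, α, β)` -/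

/-- The intersection array given by the classical parameters `(D, 1, α, β)`, with `D ≥ 3`. -/
structure HasUnitBaseArray (G : SimpleGraph X) (D : ℕ) (α β : ℝ) (c a b : ℕ → ℕ) : Prop where
  counts : G.NeighborCounts c a b
  diam_eq : G.diam = D
  three_le : 3 ≤ D
  c_eq : ∀ i ≤ D, (c i : ℝ) = i * (1 + α * (i - 1))
  b_eq : ∀ i ≤ D, (b i : ℝ) = (D - i) * (β - α * i)

theorem qBracket_one (j : ℕ) : qBracket 1 j = j := by simp [qBracket]

theorem IsDistanceRegularWith.hasUnitBaseArray {G : SimpleGraph X} {p : ℕ → ℕ → ℕ → ℕ}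
    (h : G.IsDistanceRegularWith p) {D : ℕ} (hD : 3 ≤ D) {α β : ℝ}
    (hcl : G.HasClassicalParameters p D 1 α β) :
    G.HasUnitBaseArray D α β (fun i => if i = 0 then 0 else p i 1 (i - 1)) (fun i => p i 1 i)
      (fun i => if i < G.diam then p i 1 (i + 1) else 0) := by
  obtain ⟨rfl, hc, hb⟩ := hcl
  refine ⟨h.neighborCounts (by omega), rfl, hD, ?_, ?_⟩
  · intro i hi
    rcases Nat.eq_zero_or_pos i with rfl | h0
    · simp
    · simp only [h0.ne', if_false]
      rw [hc i h0 hi, qBracket_one, qBracket_one, Nat.cast_sub h0, Nat.cast_one]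
  · intro i hi
    rcases hi.lt_or_eq with h0 | rfl
    · simp only [h0, if_true]
      rw [hb i h0, qBracket_one, qBracket_one]
    · simp

theorem mem_eigenvalueSet_iff {G : SimpleGraph X} {t : ℝ} :
    t ∈ G.eigenvalueSet ↔ ∃ f : X → ℝ, f ≠ 0 ∧ (G.adjMatrix ℝ).mulVec f = t • f := by
  rw [eigenvalueSet, ← Matrix.spectrum_toLin', ← Module.End.hasEigenvalue_iff_mem_spectrum]
  constructor
  · intro h
    obtain ⟨f, hf⟩ := h.exists_hasEigenvector
    exact ⟨f, hf.2, by simpa using hf.apply_eq_smul⟩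
  · rintro ⟨f, hf, he⟩
    exact Module.End.hasEigenvalue_of_hasEigenvector (x := f)
      ⟨Module.End.mem_eigenspace_iff.2 (by simpa using he), hf⟩

theorem NeighborCounts.mem_eigenvalueSet {G : SimpleGraph X} {c a b : ℕ → ℕ}
    (h : G.NeighborCounts c a b) {u : ℕ → ℝ} {θ : ℝ}
    (hu : ∀ i ≤ G.diam, arrayStep c a b u i = θ * u i) (h0 : u 0 ≠ 0) : θ ∈ G.eigenvalueSet := by
  have := h.connected.nonempty
  obtain ⟨y⟩ := this
  refine mem_eigenvalueSet_iff.2 ⟨(G.distMatrix u).mulVec (Pi.single y 1), ?_, ?_⟩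
  · intro h1
    have := congrFun h1 y
    simp [h0] at this
  · rw [Matrix.mulVec_mulVec, h.adjMatrix_mul_distMatrix, ← Matrix.smul_mulVec,
      ← distMatrix_smul, distMatrix_congr h.connected hu]
    rfl

theorem sum_neg_one_pow_mul_choose {D i : ℕ} (hi : i ≤ D) :
    ∑ j ∈ Finset.range (D + 1), (-1 : ℝ) ^ j * (i.choose j : ℝ) = if i = 0 then 1 else 0 := by
  have h1 : ∑ j ∈ Finset.range (i + 1), (-1 : ℝ) ^ j * (i.choose j : ℝ) =
      if i = 0 then 1 else 0 := by
    exact_mod_cast Int.alternating_sum_range_choose (n := i)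
  rw [← h1]
  symm
  apply Finset.sum_subset
  · intro j
    simp only [Finset.mem_range]
    omega
  · intro j _ hj
    simp only [Finset.mem_range, not_lt] at hj
    rw [Nat.choose_eq_zero_of_lt (by omega)]
    simp

namespace HasUnitBaseArray

variable {G : SimpleGraph X} {D : ℕ} {α β : ℝ} {c a b : ℕ → ℕ}

/-- The candidates for the eigenvalues of a graph with classical parameters `(D, 1, α, β)`. -/
def theta (D : ℕ) (α β : ℝ) (j : ℕ) : ℝ := (D - j) * (β - α * j) - j

theorem a_eq (h : G.HasUnitBaseArray D α β c a b) {i : ℕ} (hi : i ≤ D) :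
    (a i : ℝ) = D * β - i * (1 + α * (i - 1)) - (D - i) * (β - α * i) := by
  have h1 : (c i + a i + b i : ℝ) = b 0 := by
    exact_mod_cast h.counts.sum_eq_b_zero (h.diam_eq ▸ hi)
  rw [h.c_eq i hi, h.b_eq i hi, h.b_eq 0 (by omega)] at h1
  push_cast at h1
  linear_combination h1

/-- Positivity of c_3 = 3(1 + 2α) gives only α > -1/2; then c_2 = 2(1 + α) > 1, and integrality
improves this to c_2 ≥ 2. -/
theorem alpha_nonneg (h : G.HasUnitBaseArray D α β c a b) : 0 ≤ α := by
  have hD := h.three_le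
  have h2 := h.c_eq 2 (by omega)
  have h3 := h.c_eq 3 (by omega)
  have h4 : (0 : ℝ) < c 3 := by exact_mod_cast h.counts.c_pos (by omega) (h.diam_eq ▸ hD)
  push_cast at h2 h3
  have h5 : (1 : ℝ) < c 2 := by linarith
  have h6 : 2 ≤ c 2 := by exact_mod_cast h5
  have h7 : (2 : ℝ) ≤ c 2 := by exact_mod_cast h6
  linarith

theorem beta_sub_pos (h : G.HasUnitBaseArray D α β c a b) : 0 < β - α * (D - 1) := by
  have hD := h.three_le
  have h2 := h.b_eq (D - 1) (by omega)
  have h3 : (0 : ℝ) < b (D - 1) := by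
    exact_mod_cast h.counts.b_pos (by rw [h.diam_eq]; omega)
  rw [Nat.cast_sub (by omega), Nat.cast_one] at h2
  rw [h2] at h3
  linarith

theorem beta_sub_pos_of_lt (h : G.HasUnitBaseArray D α β c a b) {i : ℕ} (hi : i < D) :
    0 < β - α * i := by
  have h1 := h.beta_sub_pos
  have h2 := h.alpha_nonneg
  have h3 : (i : ℝ) ≤ D - 1 := by
    have : (i + 1 : ℝ) ≤ D := by exact_mod_cast hi
    linarith
  nlinarith

theorem arrayStep_eq (h : G.HasUnitBaseArray D α β c a b) (u : ℕ → ℝ) {i : ℕ} (hi : i ≤ D) :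
    arrayStep c a b u i = D * β * u i - i * (1 + α * (i - 1)) * (u i - u (i - 1)) +
      (D - i) * (β - α * i) * (u (i + 1) - u i) := by
  rw [arrayStep, h.c_eq i hi, h.b_eq i hi, h.a_eq hi]
  ring

/-- Differences of binomials in `i` are binomials, and the absorption identities `f1`, `f2` remove
the polynomial factors in `i`. The point is that the action is bidiagonal, so the diagonal shows the
eigenvalues. -/
theorem arrayStep_choose (h : G.HasUnitBaseArray D α β c a b) (j : ℕ) {i : ℕ} (hi : i ≤ D) :
    arrayStep c a b (fun i => (i.choose (j + 1) : ℝ)) i =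
      theta D α β (j + 1) * i.choose (j + 1) + (D - j) * (β - α * j) * i.choose j := by
  rw [h.arrayStep_eq _ hi, theta]
  have f1 : ((j : ℝ) + 1) * i.choose (j + 1) = (i - j) * i.choose j := by
    rcases le_or_gt j i with hj | hj
    · have := i.choose_succ_right_eq j
      have h1 : (i.choose (j + 1) * (j + 1) : ℝ) = i.choose j * ((i - j : ℕ) : ℝ) := by
        exact_mod_cast this
      rw [Nat.cast_sub hj] at h1
      linear_combination h1
    · rw [Nat.choose_eq_zero_of_lt hj, Nat.choose_eq_zero_of_lt (by omega)]
      simp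
  have f2 : (i : ℝ) * (i.choose (j + 1) - (i - 1).choose (j + 1)) =
      (j + 1) * i.choose (j + 1) := by
    rcases i with _ | i
    · simp
    · have := Nat.add_one_mul_choose_eq i j
      have h1 : ((i : ℝ) + 1) * i.choose j = (i + 1).choose (j + 1) * (j + 1) := by
        exact_mod_cast this
      simp only [Nat.add_sub_cancel]
      have h2 : ((i + 1).choose (j + 1) : ℝ) = i.choose j + i.choose (j + 1) := by
        exact_mod_cast Nat.choose_succ_succ' i j
      push_cast
      linear_combination h1 + ((i : ℝ) + 1) * h2
  have f3 : ((i + 1).choose (j + 1) : ℝ) = i.choose j + i.choose (j + 1) := by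
    exact_mod_cast Nat.choose_succ_succ' i j
  push_cast
  linear_combination (-(1 + α * (i - 1))) * f2 + (D - i) * (β - α * i) * f3 +
    (-(1 + α * (i - 1)) + (β + α * D + 1) - α * (j + 1)) * f1

theorem arrayStep_const (h : G.HasUnitBaseArray D α β c a b) {i : ℕ} (hi : i ≤ D) :
    arrayStep c a b (fun _ => (1 : ℝ)) i = theta D α β 0 * 1 := by
  rw [h.arrayStep_eq _ hi, theta]
  simp

/-- If `t` avoids the diagonal entries, the bidiagonal form shows by induction that all binomial
distance matrices kill an eigenvector for `t`. Their alternating sum is the identity, so the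
eigenvector would be zero. -/
theorem eq_theta_of_mem (h : G.HasUnitBaseArray D α β c a b) {t : ℝ} (ht : t ∈ G.eigenvalueSet) :
    ∃ j ≤ D, t = theta D α β j := by
  by_contra! hne
  obtain ⟨f, hf, hAf⟩ := mem_eigenvalueSet_iff.1 ht
  have hcomm : ∀ u : ℕ → ℝ, (G.distMatrix (arrayStep c a b u)).mulVec f =
      t • (G.distMatrix u).mulVec f := by
    intro u
    rw [← h.counts.distMatrix_mul_adjMatrix, ← Matrix.mulVec_mulVec, hAf, Matrix.mulVec_smul]
  have key : ∀ j ≤ D, (G.distMatrix fun i => (i.choose j : ℝ)).mulVec f = 0 := by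
    intro j
    induction j with
    | zero =>
      intro hj
      have h1 := hcomm (fun _ => 1)
      rw [distMatrix_congr (u' := theta D α β 0 • fun _ => 1) h.counts.connected
        (fun i hi => h.arrayStep_const (h.diam_eq ▸ hi)), distMatrix_smul, Matrix.smul_mulVec,
        ← sub_eq_zero, ← sub_smul] at h1
      have h2 := (smul_eq_zero.1 h1).resolve_left (sub_ne_zero.2 (hne 0 hj).symm)
      simpa using h2
    | succ j ih =>
      intro hj
      have h1 := hcomm (fun i => (i.choose (j + 1) : ℝ))
      rw [distMatrix_congr (u' := theta D α β (j + 1) • (fun i => (i.choose (j + 1) : ℝ)) +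
        ((D - j) * (β - α * j)) • fun i => (i.choose j : ℝ)) h.counts.connected
        (fun i hi => h.arrayStep_choose j (h.diam_eq ▸ hi)), distMatrix_add, distMatrix_smul,
        distMatrix_smul, Matrix.add_mulVec, Matrix.smul_mulVec, Matrix.smul_mulVec,
        ih (by omega), smul_zero, add_zero, ← sub_eq_zero, ← sub_smul] at h1
      exact (smul_eq_zero.1 h1).resolve_left (sub_ne_zero.2 (hne _ hj).symm)
  apply hf
  have h1 : (1 : Matrix X X ℝ) =
      ∑ j ∈ Finset.range (D + 1), (-1 : ℝ) ^ j • G.distMatrix (fun i => (i.choose j : ℝ)) := by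
    rw [← distMatrix_single_zero h.counts.connected]
    ext y z
    have := sum_neg_one_pow_mul_choose (h.diam_eq ▸ dist_le_diam_of_connected h.counts.connected y z)
    simp [Matrix.sum_apply, this, Pi.single_apply]
  rw [← Matrix.one_mulVec f, h1, Matrix.sum_mulVec]
  refine Finset.sum_eq_zero fun j hj => ?_
  rw [Matrix.smul_mulVec, key j (by simpa [Nat.lt_succ_iff] using hj), smul_zero]

theorem arrayStep_linear (h : G.HasUnitBaseArray D α β c a b) {i : ℕ} (hi : i ≤ D) :
    arrayStep c a b (fun i => (β + α * (D - 1) + 1) * (i : ℝ) - D * β) i =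
      theta D α β 1 * ((β + α * (D - 1) + 1) * (i : ℝ) - D * β) := by
  rw [h.arrayStep_eq _ hi, theta]
  rcases i with _ | i
  · push_cast
    ring
  · rw [Nat.add_sub_cancel]
    push_cast
    ring

/-- The standard sequence of the least eigenvalue. -/
noncomputable def leastSeq (α β : ℝ) : ℕ → ℝ
  | 0 => 1
  | i + 1 => -(1 + α * i) / (β - α * i) * leastSeq α β i

/-- The recursion turns both the b-term and the c-term into multiples of the current value. At `i =
D` the next value may come from a division by zero, but its coefficient D - i vanishes. -/
theorem arrayStep_leastSeq (h : G.HasUnitBaseArray D α β c a b) {i : ℕ} (hi : i ≤ D) :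
    arrayStep c a b (leastSeq α β) i = -D * leastSeq α β i := by
  rw [h.arrayStep_eq _ hi]
  have e1 : (D - i) * (β - α * i) * leastSeq α β (i + 1) =
      (D - i) * (-(1 + α * i) * leastSeq α β i) := by
    rcases hi.lt_or_eq with hlt | rfl
    · have := (h.beta_sub_pos_of_lt hlt).ne'
      rw [leastSeq]
      generalize β - α * i = q at this ⊢
      field_simp
    · simp
  have e2 : i * (1 + α * (i - 1)) * leastSeq α β (i - 1) =
      - (i * (β - α * (i - 1)) * leastSeq α β i) := by
    rcases i with _ | i
    · simp
    · have := (h.beta_sub_pos_of_lt (i := i) (by omega)).ne'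
      rw [Nat.add_sub_cancel, leastSeq]
      push_cast
      rw [add_sub_cancel_right]
      generalize β - α * i = q at this ⊢
      field_simp
  linear_combination e1 + e2

theorem theta_zero_mem (h : G.HasUnitBaseArray D α β c a b) : theta D α β 0 ∈ G.eigenvalueSet :=
  h.counts.mem_eigenvalueSet (u := fun _ => 1)
    (fun _ hi => h.arrayStep_const (h.diam_eq ▸ hi)) one_ne_zero

theorem theta_one_mem (h : G.HasUnitBaseArray D α β c a b) : theta D α β 1 ∈ G.eigenvalueSet := by
  refine h.counts.mem_eigenvalueSet (fun _ hi => h.arrayStep_linear (h.diam_eq ▸ hi)) ?_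
  have h1 := h.beta_sub_pos_of_lt (i := 0) (by have := h.three_le; omega)
  have h2 : (0 : ℝ) < D := by exact_mod_cast (by have := h.three_le; omega : 0 < D)
  simp only [Nat.cast_zero, mul_zero, sub_zero, zero_sub] at h1 ⊢
  exact neg_ne_zero.2 (by positivity)

theorem neg_diam_mem (h : G.HasUnitBaseArray D α β c a b) : (-D : ℝ) ∈ G.eigenvalueSet :=
  h.counts.mem_eigenvalueSet (fun _ hi => h.arrayStep_leastSeq (h.diam_eq ▸ hi))
    (by simp [leastSeq])

theorem theta_le_theta_one (h : G.HasUnitBaseArray D α β c a b) {j : ℕ} (h1 : 1 ≤ j)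
    (hj : j ≤ D) : theta D α β j ≤ theta D α β 1 := by
  have e : theta D α β 1 - theta D α β j =
      (j - 1) * (1 + (β - α * (D - 1)) + α * (D - j) + α * (D - 2)) := by
    simp only [theta]
    push_cast
    ring
  have hα := h.alpha_nonneg
  have hβ := h.beta_sub_pos
  have a1 : (0 : ℝ) ≤ j - 1 := sub_nonneg.2 (by exact_mod_cast h1)
  have a2 : (0 : ℝ) ≤ D - j := sub_nonneg.2 (by exact_mod_cast hj)
  have a3 : (0 : ℝ) ≤ D - 2 := sub_nonneg.2 (by exact_mod_cast (by have := h.three_le; omega))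
  have : 0 ≤ theta D α β 1 - theta D α β j := by
    rw [e]
    positivity
  linarith

theorem theta_one_lt_theta_zero (h : G.HasUnitBaseArray D α β c a b) :
    theta D α β 1 < theta D α β 0 := by
  have e : theta D α β 0 - theta D α β 1 = 1 + (β - α * (D - 1)) + 2 * α * (D - 1) := by
    simp only [theta]
    push_cast
    ring
  have hα := h.alpha_nonneg
  have hβ := h.beta_sub_pos
  have a3 : (0 : ℝ) ≤ D - 1 := sub_nonneg.2 (by exact_mod_cast (by have := h.three_le; omega))
  have : 0 < theta D α β 0 - theta D α β 1 := by
    rw [e]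
    positivity
  linarith

theorem neg_diam_le_theta (h : G.HasUnitBaseArray D α β c a b) {j : ℕ} (hj : j ≤ D) :
    (-D : ℝ) ≤ theta D α β j := by
  rcases hj.lt_or_eq with hlt | rfl
  · have h1 := h.beta_sub_pos_of_lt hlt
    have a2 : (0 : ℝ) ≤ D - j := sub_nonneg.2 (by exact_mod_cast hj)
    have : 0 ≤ (D - j) * (β - α * j + 1) := by positivity
    simp only [theta]
    linarith
  · simp [theta]

/-- It suffices that the candidates with indices 0 and 1 are eigenvalues and that all later
candidates are at most the one with index 1. -/
theorem secondEigenvalue_eq (h : G.HasUnitBaseArray D α β c a b) :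
    G.secondEigenvalue = theta D α β 1 := by
  refine IsGreatest.csSup_eq ⟨⟨h.theta_one_mem, _, h.theta_zero_mem, h.theta_one_lt_theta_zero⟩, ?_⟩
  rintro t ⟨ht, s, hs, hts⟩
  obtain ⟨j, hj, rfl⟩ := h.eq_theta_of_mem ht
  obtain ⟨i, hi, rfl⟩ := h.eq_theta_of_mem hs
  rcases Nat.eq_zero_or_pos j with rfl | h0
  · exfalso
    rcases Nat.eq_zero_or_pos i with rfl | h1
    · exact lt_irrefl _ hts
    · have := h.theta_le_theta_one h1 hi
      have := h.theta_one_lt_theta_zero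
      linarith
  · exact h.theta_le_theta_one h0 hj

theorem leastEigenvalue_eq (h : G.HasUnitBaseArray D α β c a b) : G.leastEigenvalue = -D := by
  refine IsLeast.csInf_eq ⟨h.neg_diam_mem, ?_⟩
  intro t ht
  obtain ⟨j, hj, rfl⟩ := h.eq_theta_of_mem ht
  exact h.neg_diam_le_theta hj

/-- Colour by the parity of the distance to a fixed vertex; an edge within a colour class would join
two vertices of one sphere. -/
theorem isBipartite_of_a_eq_zero (h : G.HasUnitBaseArray D α β c a b)
    (ha : ∀ i ≤ D, a i = 0) : G.IsBipartite := by
  have := h.counts.connected.nonempty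
  obtain ⟨x⟩ := this
  refine ⟨Coloring.mk (fun y => (⟨G.dist y x % 2, Nat.mod_lt _ two_pos⟩ : Fin 2)) ?_⟩
  intro y w hyw heq
  have h1 := hyw.dist_bounds h.counts.connected x
  have h2 : G.dist y x % 2 = G.dist w x % 2 := congrArg Fin.val heq
  have h3 : G.dist w x = G.dist y x := by omega
  have h4 := ha _ (h.diam_eq ▸ dist_le_diam_of_connected h.counts.connected y x)
  rw [← h.counts.card_a, Finset.card_eq_zero, Finset.filter_eq_empty_iff] at h4
  exact h4 (Finset.mem_univ w) ⟨hyw, h3⟩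

theorem beta_eq_of_tight (h : G.HasUnitBaseArray D α β c a b)
    (ht : (G.secondEigenvalue + (b 0 : ℝ) / ((a 1 : ℝ) + 1)) *
      (G.leastEigenvalue + (b 0 : ℝ) / ((a 1 : ℝ) + 1)) =
        -((b 0 : ℝ) * (a 1 : ℝ) * (b 1 : ℝ)) / ((a 1 : ℝ) + 1) ^ 2) :
    β = 1 + α * (D - 1) := by
  have hD := h.three_le
  rw [h.secondEigenvalue_eq, h.leastEigenvalue_eq] at ht
  have e0 := h.b_eq 0 (by omega)
  have e1 := h.b_eq 1 (by omega)
  have e2 := h.a_eq (i := 1) (by omega)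
  push_cast at e0 e1 e2
  have e3 : (a 1 : ℝ) + 1 = β + α * (D - 1) := by
    rw [e2]
    ring
  have hpos : (0 : ℝ) < β + α * (D - 1) := by
    rw [← e3]
    positivity
  have e4 : (a 1 : ℝ) = β + α * (D - 1) - 1 := by linarith
  rw [e3, e4, e0, e1, theta] at ht
  push_cast at ht
  have hs : ∀ u v k w s : ℝ, s ≠ 0 → (u + k / s) * (v + k / s) = w / s ^ 2 →
      (u * s + k) * (v * s + k) = w := by
    intro u v k w s hs h1
    field_simp at h1
    linear_combination h1
  replace ht := hs _ _ _ _ _ hpos.ne' ht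
  have hD1 : (0 : ℝ) < D - 1 := sub_pos.2 (by exact_mod_cast (by omega))
  have hD0 : (0 : ℝ) < D := by linarith
  have hβ1 := h.beta_sub_pos_of_lt (i := 1) (by omega)
  push_cast at hβ1
  -- With denominators cleared, the tightness equation factors, and all factors but β - (1 + α(D -
  -- 1)) are positive.
  have hne : D * (D - 1) * (β - α * 1) * (β + α * (D - 1)) ≠ 0 := by positivity
  have : D * (D - 1) * (β - α * 1) * (β + α * (D - 1)) * (β - (1 + α * (D - 1))) = 0 := by
    linear_combination ht
  have := (mul_eq_zero.1 this).resolve_left hne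
  linarith

theorem alpha_pos_of_not_isBipartite (h : G.HasUnitBaseArray D α β c a b)
    (hβ : β = 1 + α * (D - 1)) (hb : ¬ G.IsBipartite) : 0 < α := by
  refine lt_of_le_of_ne h.alpha_nonneg fun h0 => hb (h.isBipartite_of_a_eq_zero fun i hi => ?_)
  have := h.a_eq hi
  rw [hβ, ← h0] at this
  have h1 : (a i : ℝ) = 0 := by
    rw [this]
    ring
  exact_mod_cast h1

end HasUnitBaseArray

/-! ### The projection onto the local subspace -/

/-- The distance matrix of a real sequence, with complex entries. -/
noncomputable abbrev cDistMatrix (G : SimpleGraph X) (u : ℕ → ℝ) : Matrix X X ℂ :=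
  G.distMatrix fun i => (u i : ℂ)

/-- The characteristic vector of the neighbourhood of `x`. -/
noncomputable def localOne (G : SimpleGraph X) (x : X) : X → ℂ :=
  fun y => if G.dist x y = 1 then 1 else 0

theorem dualIdempotent_one_eq (G : SimpleGraph X) (x : X) :
    G.dualIdempotent x 1 = Matrix.diagonal (G.localOne x) := rfl

theorem dualIdempotent_mulVec (G : SimpleGraph X) (x : X) (i : ℕ) (f : X → ℂ) (y : X) :
    (G.dualIdempotent x i).mulVec f y = if G.dist x y = i then f y else 0 := by
  simp [dualIdempotent, Matrix.mulVec_diagonal]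

/-- The sum of `u (dist y z)` over the neighbours `z` of `x`, for a neighbour `y` of `x`. -/
noncomputable def localSum (c a b : ℕ → ℕ) (u : ℕ → ℝ) : ℝ :=
  c 1 * u 0 + a 1 * u 1 + b 1 * u 2

/-- The orthogonal projection onto the functions on the neighbourhood of `x` with sum zero, when
`k` is the degree of `x`. -/
noncomputable def localProj (G : SimpleGraph X) (x : X) (k : ℕ) : Matrix X X ℂ :=
  Matrix.diagonal (G.localOne x) - (k : ℂ)⁻¹ • Matrix.vecMulVec (G.localOne x) (G.localOne x)

namespace NeighborCounts

variable {G : SimpleGraph X} {c a b : ℕ → ℕ}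

theorem cDistMatrix_mul_self (h : G.NeighborCounts c a b) {u : ℕ → ℝ} {θ : ℝ}
    (hu : ∀ i ≤ G.diam, arrayStep c a b u i = θ * u i) :
    ∃ l : ℂ, G.cDistMatrix u * G.cDistMatrix u = l • G.cDistMatrix u := by
  refine h.distMatrix_mul_self (θ := (θ : ℂ)) fun i hi => ?_
  have := hu i hi
  simp only [arrayStep] at this ⊢
  exact_mod_cast this

theorem cDistMatrix_mulVec_localOne (h : G.NeighborCounts c a b) (u : ℕ → ℝ) {x y : X}
    (hy : G.dist x y = 1) : (G.cDistMatrix u).mulVec (G.localOne x) y = localSum c a b u := by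
  have h1 := h.sum_adj (fun i => (u i : ℂ)) x y
  rw [hy] at h1
  simp only [localSum, Matrix.mulVec, dotProduct, distMatrix_apply, localOne]
  push_cast
  rw [← h1]
  simp only [mul_ite, mul_one, mul_zero, dist_eq_one_iff_adj]
  rw [← Finset.sum_filter]
  refine Finset.sum_congr ?_ fun w _ => by rw [G.dist_comm]
  ext; simp

theorem sum_localOne (h : G.NeighborCounts c a b) (x : X) :
    G.localOne x ⬝ᵥ G.localOne x = b 0 := by
  rw [← h.card_neighborFinset_eq x]
  have : G.neighborFinset x = Finset.univ.filter fun y => G.dist x y = 1 := by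
    ext; simp [dist_eq_one_iff_adj]
  rw [this, Finset.card_filter, dotProduct, Nat.cast_sum]
  refine Finset.sum_congr rfl fun y _ => ?_
  simp only [localOne]
  split_ifs <;> simp

theorem diagonal_mul_cDistMatrix_mul (h : G.NeighborCounts c a b) (u : ℕ → ℝ) (x : X) :
    Matrix.diagonal (G.localOne x) * (G.cDistMatrix u *
      Matrix.vecMulVec (G.localOne x) (G.localOne x)) =
        (localSum c a b u : ℂ) • Matrix.vecMulVec (G.localOne x) (G.localOne x) := by
  rw [Matrix.mul_vecMulVec, Matrix.mul_vecMulVec, ← Matrix.smul_vecMulVec]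
  congr 1
  ext y
  rw [Matrix.mulVec_diagonal]
  by_cases hy : G.dist x y = 1
  · rw [h.cDistMatrix_mulVec_localOne u hy]
    simp [localOne, hy]
  · simp [localOne, hy]

theorem localOne_dotProduct_cDistMatrix (h : G.NeighborCounts c a b) (u : ℕ → ℝ) (x : X) :
    G.localOne x ⬝ᵥ (G.cDistMatrix u).mulVec (G.localOne x) = b 0 * localSum c a b u := by
  rw [← h.sum_localOne x, dotProduct, dotProduct, Finset.sum_mul]
  refine Finset.sum_congr rfl fun y _ => ?_
  by_cases hy : G.dist x y = 1
  · rw [h.cDistMatrix_mulVec_localOne u hy]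
    simp [localOne, hy]
  · simp [localOne, hy]

theorem mul_cDistMatrix_mul_diagonal (h : G.NeighborCounts c a b) (u : ℕ → ℝ) (x : X) :
    Matrix.vecMulVec (G.localOne x) (G.localOne x) * (G.cDistMatrix u *
      Matrix.diagonal (G.localOne x)) =
        (localSum c a b u : ℂ) • Matrix.vecMulVec (G.localOne x) (G.localOne x) := by
  have := congrArg Matrix.transpose (h.diagonal_mul_cDistMatrix_mul u x)
  simpa [Matrix.transpose_mul, transpose_distMatrix, Matrix.mul_assoc,
    Matrix.transpose_vecMulVec] using this

/-- The constant vector on the neighbourhood is an eigenvector of the local block, so one cross term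
cancels the rank-one square term. -/
theorem localProj_mul_mul (h : G.NeighborCounts c a b) (hb : b 0 ≠ 0) (u : ℕ → ℝ) (x : X) :
    G.localProj x (b 0) * (G.cDistMatrix u * G.localProj x (b 0)) =
      Matrix.diagonal (G.localOne x) * (G.cDistMatrix u * Matrix.diagonal (G.localOne x)) -
        ((b 0 : ℂ)⁻¹ * localSum c a b u) •
          Matrix.vecMulVec (G.localOne x) (G.localOne x) := by
  have hk : (b 0 : ℂ) ≠ 0 := by exact_mod_cast hb
  have h3 : Matrix.vecMulVec (G.localOne x) (G.localOne x) * (G.cDistMatrix u *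
      Matrix.vecMulVec (G.localOne x) (G.localOne x)) =
        ((b 0 : ℂ) * localSum c a b u) • Matrix.vecMulVec (G.localOne x) (G.localOne x) := by
    rw [Matrix.mul_vecMulVec, Matrix.vecMulVec_mul_vecMulVec, h.localOne_dotProduct_cDistMatrix]
    simp [Matrix.vecMulVec_smul]
  simp only [localProj, Matrix.mul_sub, Matrix.sub_mul, Matrix.mul_smul, Matrix.smul_mul,
    h.diagonal_mul_cDistMatrix_mul, h.mul_cDistMatrix_mul_diagonal, h3, smul_smul]
  rw [inv_mul_cancel_left₀ hk, sub_self, smul_zero, sub_zero]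

/-- This is the entrywise inner product of the two local blocks after removal of their constant
parts. It depends only on the array because each row of a local block has sum `localSum`. -/
theorem trace_localProj (h : G.NeighborCounts c a b) (hb : b 0 ≠ 0) (u u' : ℕ → ℝ) (x : X) :
    (G.localProj x (b 0) * (G.cDistMatrix u * G.localProj x (b 0)) * G.cDistMatrix u').trace =
      b 0 * localSum c a b (fun i => u i * u' i) - localSum c a b u * localSum c a b u' := by
  have hk : (b 0 : ℂ) ≠ 0 := by exact_mod_cast hb
  rw [h.localProj_mul_mul hb, Matrix.sub_mul, Matrix.trace_sub, Matrix.smul_mul, Matrix.trace_smul]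
  have h1 : (Matrix.vecMulVec (G.localOne x) (G.localOne x) * G.cDistMatrix u').trace =
      b 0 * localSum c a b u' := by
    rw [← h.localOne_dotProduct_cDistMatrix, Matrix.trace_mul_comm, Matrix.mul_vecMulVec,
      Matrix.trace_vecMulVec, dotProduct_comm]
  have h2 : (Matrix.diagonal (G.localOne x) *
      (G.cDistMatrix u * Matrix.diagonal (G.localOne x)) * G.cDistMatrix u').trace =
        b 0 * localSum c a b (fun i => u i * u' i) := by
    rw [← h.localOne_dotProduct_cDistMatrix]
    simp only [Matrix.trace, Matrix.diag_apply, dotProduct, Matrix.mulVec]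
    refine Finset.sum_congr rfl fun y _ => ?_
    rw [Matrix.mul_apply, Finset.mul_sum]
    refine Finset.sum_congr rfl fun z _ => ?_
    rw [Matrix.diagonal_mul, Matrix.mul_diagonal]
    simp only [distMatrix_apply, G.dist_comm (u := z)]
    push_cast
    ring
  rw [h1, h2, smul_eq_mul]
  field_simp

theorem conjTranspose_cDistMatrix (u : ℕ → ℝ) :
    (G.cDistMatrix u).conjTranspose = G.cDistMatrix u := by
  ext y z
  simp [Matrix.conjTranspose_apply, G.dist_comm (u := y)]

theorem conjTranspose_localProj (x : X) (k : ℕ) :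
    (G.localProj x k).conjTranspose = G.localProj x k := by
  have h1 : star (G.localOne x) = G.localOne x := by
    ext y
    simp only [localOne, Pi.star_apply]
    split_ifs <;> simp
  simp [localProj, Matrix.conjTranspose_sub, Matrix.conjTranspose_smul,
    Matrix.diagonal_conjTranspose, Matrix.conjTranspose_vecMulVec, h1]

open scoped ComplexOrder in
/-- If two eigenspaces of `G` give local Gram matrices of trace product zero, these annihilate each
other. -/
theorem cDistMatrix_mul_localProj_mul (h : G.NeighborCounts c a b) (hb : b 0 ≠ 0)
    {u u' : ℕ → ℝ} {θ θ' : ℝ} (hu : ∀ i ≤ G.diam, arrayStep c a b u i = θ * u i)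
    (hu' : ∀ i ≤ G.diam, arrayStep c a b u' i = θ' * u' i)
    (htr : b 0 * localSum c a b (fun i => u i * u' i) = localSum c a b u * localSum c a b u')
    (x : X) : G.cDistMatrix u * (G.localProj x (b 0) * G.cDistMatrix u') = 0 := by
  obtain ⟨l, hl⟩ := h.cDistMatrix_mul_self hu
  obtain ⟨l', hl'⟩ := h.cDistMatrix_mul_self hu'
  -- With N = M E M', the trace of N*N is that of M' E M M E M'. Since M² and M'² are multiples of M
  -- and M', it is a multiple of tr(E M E M') = 0, hence N = 0.
  rw [← Matrix.trace_conjTranspose_mul_self_eq_zero_iff]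
  have htr' := h.trace_localProj hb u u' x
  rw [sub_eq_zero.2 (by exact_mod_cast htr)] at htr'
  set M := G.cDistMatrix u with hM
  set M' := G.cDistMatrix u' with hM'
  set E := G.localProj x (b 0) with hE
  have e : (M * (E * M')).conjTranspose = M' * E * M := by
    rw [Matrix.conjTranspose_mul, Matrix.conjTranspose_mul, conjTranspose_cDistMatrix,
      conjTranspose_cDistMatrix, conjTranspose_localProj]
  have e2 : M' * E * M * (M * (E * M')) = l • (M' * (E * (M * E) * M')) := by
    calc M' * E * M * (M * (E * M')) = M' * E * (M * M) * (E * M') := by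
          simp only [Matrix.mul_assoc]
      _ = _ := by
          rw [hl]
          simp only [Matrix.mul_assoc, Matrix.smul_mul, Matrix.mul_smul]
  rw [e, e2, Matrix.trace_smul, Matrix.trace_mul_comm, Matrix.mul_assoc _ M' M', hl',
    Matrix.mul_smul, Matrix.trace_smul, htr', smul_zero, smul_zero]

end NeighborCounts

/-- `v` is supported on the neighbourhood of `x` and its entries have sum zero. -/
structure IsLocalVector (G : SimpleGraph X) (x : X) (v : X → ℂ) : Prop where
  support : ∀ y, G.dist x y ≠ 1 → v y = 0
  sum_eq : ∑ y, v y = 0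

/-- The action of the local graph, shifted by a scalar. -/
noncomputable def localShift (G : SimpleGraph X) (x : X) (η : ℝ) (v : X → ℂ) : X → ℂ :=
  (G.dualIdempotent x 1).mulVec (G.cAdj.mulVec v) - (η : ℂ) • v

theorem cAdj_mulVec_apply (G : SimpleGraph X) (v : X → ℂ) (y : X) :
    G.cAdj.mulVec v y = ∑ z, if G.Adj y z then v z else 0 := by
  simp [cAdj, Matrix.mulVec, dotProduct, adjMatrix_apply]

theorem cAdj_eq_cDistMatrix (G : SimpleGraph X) :
    G.cAdj = G.cDistMatrix (fun i => if i = 1 then 1 else 0) := by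
  ext y z
  simp only [cAdj, adjMatrix_apply, distMatrix_apply, dist_eq_one_iff_adj]
  split_ifs <;> simp

/-! ### Distance matrices acting on local vectors -/

namespace IsLocalVector

variable {G : SimpleGraph X} {c a b : ℕ → ℕ} {x : X} {v : X → ℂ}

/-- The local block is symmetric with the constant vector as eigenvector, so it preserves the
orthogonal complement of that vector. -/
theorem sum_cDistMatrix (hv : G.IsLocalVector x v) (h : G.NeighborCounts c a b) (u : ℕ → ℝ) :
    G.localOne x ⬝ᵥ (G.cDistMatrix u).mulVec v = 0 := by
  rw [Matrix.dotProduct_mulVec, ← Matrix.mulVec_transpose, transpose_distMatrix, dotProduct]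
  calc _ = ∑ y, (localSum c a b u : ℂ) * v y := by
        refine Finset.sum_congr rfl fun y _ => ?_
        by_cases hy : G.dist x y = 1
        · rw [h.cDistMatrix_mulVec_localOne u hy]
        · rw [hv.support y hy]
          simp
    _ = 0 := by rw [← Finset.mul_sum, hv.sum_eq, mul_zero]

theorem localProj_mulVec (hv : G.IsLocalVector x v) (h : G.NeighborCounts c a b) (u : ℕ → ℝ)
    (k : ℕ) : (G.localProj x k).mulVec ((G.cDistMatrix u).mulVec v) =
      (G.dualIdempotent x 1).mulVec ((G.cDistMatrix u).mulVec v) := by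
  rw [localProj, Matrix.sub_mulVec, Matrix.smul_mulVec, Matrix.vecMulVec_mulVec,
    hv.sum_cDistMatrix h, dualIdempotent_one_eq]
  simp

/-- Two neighbours of `x` are at distance at most 2, so the local block is u_0 I + u_1 A_loc + u_2
(J - I - A_loc), and J kills sum-zero vectors. -/
theorem dualIdempotent_mulVec_cDistMatrix (hv : G.IsLocalVector x v) (hc : G.Connected)
    (u : ℕ → ℝ) : (G.dualIdempotent x 1).mulVec ((G.cDistMatrix u).mulVec v) =
      ((u 0 - u 2 : ℝ) : ℂ) • v +
        ((u 1 - u 2 : ℝ) : ℂ) • (G.dualIdempotent x 1).mulVec (G.cAdj.mulVec v) := by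
  ext y
  simp only [dualIdempotent_mulVec, Pi.add_apply, Pi.smul_apply, smul_eq_mul]
  by_cases hy : G.dist x y = 1
  · simp only [hy, if_true, cAdj_mulVec_apply]
    have h1 : v y = ∑ z, if y = z then v z else 0 := by simp
    have h2 : (G.cDistMatrix u).mulVec v y = ∑ z, ((u 2 : ℂ) * v z + ((u 0 - u 2 : ℝ) : ℂ) *
        (if y = z then v z else 0) + ((u 1 - u 2 : ℝ) : ℂ) * (if G.Adj y z then v z else 0)) := by
      refine Finset.sum_congr rfl fun z _ => ?_
      simp only [distMatrix_apply]
      by_cases hz : G.dist x z = 1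
      · have h3 := hc.dist_triangle (u := y) (v := x) (w := z)
        rw [G.dist_comm (u := y) (v := x), hy, hz] at h3
        by_cases e0 : y = z
        · subst e0
          simp
          ring
        · have e1 : G.dist y z ≠ 0 := fun e => e0 (hc.dist_eq_zero_iff.1 e)
          by_cases e2 : G.Adj y z
          · simp [e0, e2, dist_eq_one_iff_adj.2 e2]
            ring
          · have e3 : G.dist y z ≠ 1 := fun e => e2 (dist_eq_one_iff_adj.1 e)
            simp [e0, e2, show G.dist y z = 2 by omega]
      · simp [hv.support z hz]
    rw [h2, Finset.sum_add_distrib, Finset.sum_add_distrib, ← Finset.mul_sum, hv.sum_eq,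
      ← Finset.mul_sum, ← Finset.mul_sum, ← h1]
    simp
  · simp [hy, hv.support y hy]

theorem localShift (hv : G.IsLocalVector x v) (h : G.NeighborCounts c a b) (η : ℝ) :
    G.IsLocalVector x (G.localShift x η v) where
  support y hy := by
    simp [SimpleGraph.localShift, dualIdempotent_mulVec, hy, hv.support y hy,
      -Matrix.mulVec_mulVec]
  sum_eq := by
    have h1 := hv.sum_cDistMatrix h (fun i => if i = 1 then 1 else 0)
    rw [← cAdj_eq_cDistMatrix] at h1
    simp only [SimpleGraph.localShift, Pi.sub_apply, Finset.sum_sub_distrib, Pi.smul_apply,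
      ← Finset.smul_sum, hv.sum_eq, smul_zero, sub_zero]
    rw [← h1]
    refine Finset.sum_congr rfl fun y _ => ?_
    simp [dualIdempotent_mulVec, localOne]

/-- Shifting by the local eigenvalue that belongs to `u'` maps local vectors to the kernel of the
matrix of `u`. -/
theorem cDistMatrix_mulVec_localShift (hv : G.IsLocalVector x v) (h : G.NeighborCounts c a b)
    (hb : b 0 ≠ 0) {u u' : ℕ → ℝ} {θ θ' η : ℝ}
    (hu : ∀ i ≤ G.diam, arrayStep c a b u i = θ * u i)
    (hu' : ∀ i ≤ G.diam, arrayStep c a b u' i = θ' * u' i)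
    (htr : b 0 * localSum c a b (fun i => u i * u' i) = localSum c a b u * localSum c a b u')
    (hη : u' 0 - u' 2 = -η * (u' 1 - u' 2)) (hne : u' 1 - u' 2 ≠ 0) :
    (G.cDistMatrix u).mulVec (G.localShift x η v) = 0 := by
  have h1 := congrArg (fun M => M.mulVec v) (h.cDistMatrix_mul_localProj_mul hb hu hu' htr x)
  simp only [← Matrix.mulVec_mulVec, Matrix.zero_mulVec, hv.localProj_mulVec h,
    hv.dualIdempotent_mulVec_cDistMatrix h.connected, hη] at h1
  have h2 : ((-η * (u' 1 - u' 2) : ℝ) : ℂ) • v + ((u' 1 - u' 2 : ℝ) : ℂ) •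
      (G.dualIdempotent x 1).mulVec (G.cAdj.mulVec v) =
        ((u' 1 - u' 2 : ℝ) : ℂ) • G.localShift x η v := by
    rw [SimpleGraph.localShift]
    push_cast
    module
  rw [h2, Matrix.mulVec_smul] at h1
  exact (smul_eq_zero.1 h1).resolve_left (by exact_mod_cast hne)

end IsLocalVector

/-! ### Kernel conditions for local vectors of a tight graph -/

namespace HasUnitBaseArray

variable {G : SimpleGraph X} {D : ℕ} {α : ℝ} {c a b : ℕ → ℕ}

/-- The standard sequence of the second largest eigenvalue of a tight graph. -/
def linSeq (D : ℕ) (i : ℕ) : ℝ := D - 2 * i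

theorem arrayStep_linSeq (h : G.HasUnitBaseArray D α (1 + α * (D - 1)) c a b) {i : ℕ}
    (hi : i ≤ D) :
    arrayStep c a b (linSeq D) i = theta D α (1 + α * (D - 1)) 1 * linSeq D i := by
  rw [h.arrayStep_eq _ hi, theta]
  simp only [linSeq]
  rcases i with _ | i
  · push_cast
    ring
  · rw [Nat.add_sub_cancel]
    push_cast
    ring

theorem pos_of_lt (h : G.HasUnitBaseArray D α (1 + α * (D - 1)) c a b) {i : ℕ} (hi : i < D) :
    0 < 1 + α * (D - 1 - i) := by
  have := h.beta_sub_pos_of_lt hi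
  linarith

theorem one_add_pos (h : G.HasUnitBaseArray D α (1 + α * (D - 1)) c a b) (i : ℕ) :
    0 < 1 + α * i := by
  have := h.alpha_nonneg
  positivity

theorem leastSeq_ne_zero (h : G.HasUnitBaseArray D α (1 + α * (D - 1)) c a b) {i : ℕ}
    (hi : i ≤ D) : leastSeq α (1 + α * (D - 1)) i ≠ 0 := by
  induction i with
  | zero => simp [leastSeq]
  | succ i ih =>
    have h1 := h.beta_sub_pos_of_lt (i := i) (by omega)
    have h2 := h.one_add_pos i
    rw [leastSeq]
    exact mul_ne_zero (div_ne_zero (neg_ne_zero.2 h2.ne') h1.ne') (ih (by omega))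

theorem leastSeq_succ (h : G.HasUnitBaseArray D α (1 + α * (D - 1)) c a b) {i : ℕ}
    (hi : i < D) : (1 + α * (D - 1 - i)) * leastSeq α (1 + α * (D - 1)) (i + 1) =
      -(1 + α * i) * leastSeq α (1 + α * (D - 1)) i := by
  have h1 := (h.beta_sub_pos_of_lt hi).ne'
  rw [leastSeq, show 1 + α * (D - 1 - i) = 1 + α * (D - 1) - α * i by ring]
  generalize 1 + α * (D - 1) - α * i = q at h1 ⊢
  field_simp

theorem b_zero_ne_zero (h : G.HasUnitBaseArray D α (1 + α * (D - 1)) c a b) : b 0 ≠ 0 :=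
  (h.counts.b_pos (by have := h.three_le; have := h.diam_eq; omega)).ne'

/-- This is the vanishing of the local trace, and it relies on the tight value of β. -/
theorem localSum_mul (h : G.HasUnitBaseArray D α (1 + α * (D - 1)) c a b) :
    b 0 * localSum c a b (fun i => linSeq D i * leastSeq α (1 + α * (D - 1)) i) =
      localSum c a b (linSeq D) * localSum c a b (leastSeq α (1 + α * (D - 1))) := by
  have hD := h.three_le
  have e1 := h.leastSeq_succ (i := 0) (by omega)
  have e2 := h.leastSeq_succ (i := 1) (by omega)
  have p1 := (h.pos_of_lt (i := 0) (by omega)).ne'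
  have p2 := (h.pos_of_lt (i := 1) (by omega)).ne'
  have e0 : leastSeq α (1 + α * (D - 1)) 0 = 1 := rfl
  simp only [localSum]
  rw [h.b_eq 0 (by omega), h.b_eq 1 (by omega), h.a_eq (i := 1) (by omega),
    h.c_eq 1 (by omega), e0]
  rw [e0] at e1
  simp only [linSeq]
  push_cast at *
  generalize leastSeq α (1 + α * (D - 1)) 1 = u1 at *
  generalize leastSeq α (1 + α * (D - 1)) 2 = u2 at *
  have f1 : u1 = -1 / (1 + α * (D - 1)) := by
    rw [sub_zero] at p1 e1
    rw [eq_div_iff p1]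
    linear_combination e1
  have f2 : u2 = -(1 + α) * u1 / (1 + α * (D - 1 - 1)) := by
    rw [eq_div_iff p2]
    linear_combination e2
  rw [f2, f1]
  rw [sub_zero] at p1
  field_simp
  ring

theorem localSum_mul' (h : G.HasUnitBaseArray D α (1 + α * (D - 1)) c a b) :
    b 0 * localSum c a b (fun i => leastSeq α (1 + α * (D - 1)) i * linSeq D i) =
      localSum c a b (leastSeq α (1 + α * (D - 1))) * localSum c a b (linSeq D) := by
  rw [mul_comm (localSum c a b (leastSeq α (1 + α * (D - 1)))), ← h.localSum_mul]
  simp only [mul_comm (leastSeq α _ _)]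

/-- The shift comes from the other sequence: α(D - 2) is -(u_0 - u_2)/(u_1 - u_2) for u =
`leastSeq`, just as -2 is this quotient for `linSeq`. -/
theorem linSeq_mulVec_localShift (h : G.HasUnitBaseArray D α (1 + α * (D - 1)) c a b) {x : X}
    {v : X → ℂ} (hv : G.IsLocalVector x v) :
    (G.cDistMatrix (linSeq D)).mulVec (G.localShift x (α * (D - 2)) v) = 0 := by
  have hD := h.three_le
  have e1 := h.leastSeq_succ (i := 0) (by omega)
  have e2 := h.leastSeq_succ (i := 1) (by omega)
  have p1 := h.pos_of_lt (i := 0) (by omega)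
  have p2 := h.pos_of_lt (i := 1) (by omega)
  have hα := h.alpha_nonneg
  have hn := h.leastSeq_ne_zero (i := 1) (by omega)
  have e0 : leastSeq α (1 + α * (D - 1)) 0 = 1 := rfl
  push_cast at e1 e2 p1 p2
  have key : (1 + α * (D - 1 - 1)) * (leastSeq α (1 + α * (D - 1)) 1 -
      leastSeq α (1 + α * (D - 1)) 2) =
        (1 + α * (D - 1 - 0) + 1) * leastSeq α (1 + α * (D - 1)) 1 := by
    linear_combination -e2
  have hne : leastSeq α (1 + α * (D - 1)) 1 - leastSeq α (1 + α * (D - 1)) 2 ≠ 0 := by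
    intro h0
    rw [h0, mul_zero] at key
    exact mul_ne_zero (by positivity) hn key.symm
  refine hv.cDistMatrix_mulVec_localShift h.counts h.b_zero_ne_zero
    (fun i hi => h.arrayStep_linSeq (h.diam_eq ▸ hi))
    (fun i hi => h.arrayStep_leastSeq (h.diam_eq ▸ hi)) h.localSum_mul ?_ hne
  rw [e0] at e1 ⊢
  have : (1 + α * (D - 1 - 1)) * (1 - leastSeq α (1 + α * (D - 1)) 2 +
      (α * (D - 2)) * (leastSeq α (1 + α * (D - 1)) 1 - leastSeq α (1 + α * (D - 1)) 2)) = 0 := by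
    linear_combination -(1 + α * (D - 2)) * e2 + (1 + α * (D - 2)) * e1
  have := (mul_eq_zero.1 this).resolve_left p2.ne'
  linarith

theorem leastSeq_mulVec_localShift (h : G.HasUnitBaseArray D α (1 + α * (D - 1)) c a b) {x : X}
    {v : X → ℂ} (hv : G.IsLocalVector x v) :
    (G.cDistMatrix (leastSeq α (1 + α * (D - 1)))).mulVec (G.localShift x (-2) v) = 0 := by
  refine hv.cDistMatrix_mulVec_localShift h.counts h.b_zero_ne_zero
    (fun i hi => h.arrayStep_leastSeq (h.diam_eq ▸ hi))
    (fun i hi => h.arrayStep_linSeq (h.diam_eq ▸ hi)) h.localSum_mul' ?_ ?_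
  · simp only [linSeq]
    push_cast
    ring
  · simp only [linSeq]
    push_cast
    ring_nf
    norm_num

end HasUnitBaseArray

/-! ### Ladders -/

/-- A sequence of vectors, one on each sphere around `x`, on which the adjacency matrix acts in a
tridiagonal way. -/
structure IsLadder (G : SimpleGraph X) (x : X) (D : ℕ) (up flat down : ℕ → ℝ)
    (w : ℕ → X → ℂ) : Prop where
  zero : w 0 = 0
  top : w D = 0
  support : ∀ r y, G.dist x y ≠ r → w r y = 0
  cAdj_mulVec : ∀ r, r + 1 < D → G.cAdj.mulVec (w (r + 1)) =
    (up (r + 1) : ℂ) • w (r + 2) + (flat (r + 1) : ℂ) • w (r + 1) + (down (r + 1) : ℂ) • w r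

/-- The sum of a local vector over the sphere of radius `i` around each vertex. -/
noncomputable def sphereSum (G : SimpleGraph X) (v : X → ℂ) (i : ℕ) : X → ℂ :=
  (G.distMatrix (Pi.single i (1 : ℂ))).mulVec v

/-- The part of the sphere sums of `v` that lies one level above, normalized by `s`. -/
noncomputable def ladderVec (G : SimpleGraph X) (x : X) (s : ℕ → ℝ) (v : X → ℂ) : ℕ → X → ℂ
  | 0 => 0
  | r + 1 => fun z => if G.dist x z = r + 1 then ((s (r + 1) : ℝ) : ℂ)⁻¹ * G.sphereSum v r z else 0

namespace IsLocalVector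

variable {G : SimpleGraph X} {c a b : ℕ → ℕ} {x : X} {v : X → ℂ}

/-- From a vertex at distance i + 1 from `x`, each neighbour of `x` is at distance i, i + 1 or i +
2. -/
theorem distMatrix_mulVec_apply (hv : G.IsLocalVector x v) (hc : G.Connected) (g : ℕ → ℂ) {z : X}
    {i : ℕ} (hz : G.dist x z = i + 1) :
    (G.distMatrix g).mulVec v z = g i * G.sphereSum v i z +
      g (i + 1) * G.sphereSum v (i + 1) z + g (i + 2) * G.sphereSum v (i + 2) z := by
  simp only [sphereSum, Matrix.mulVec, dotProduct, Finset.mul_sum, ← Finset.sum_add_distrib,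
    distMatrix_apply]
  refine Finset.sum_congr rfl fun y _ => ?_
  by_cases hy : G.dist x y = 1
  · have h1 := hc.dist_triangle (u := z) (v := x) (w := y)
    have h2 := hc.dist_triangle (u := z) (v := y) (w := x)
    rw [G.dist_comm (u := z) (v := x), hz, hy] at h1
    rw [G.dist_comm (u := z) (v := x), hz, G.dist_comm (u := y) (v := x), hy] at h2
    rcases (by omega : G.dist z y = i ∨ G.dist z y = i + 1 ∨ G.dist z y = i + 2) with e | e | e <;>
      simp [e]
  · simp [hv.support y hy]

theorem sphereSum_eq_zero (hv : G.IsLocalVector x v) (hc : G.Connected) {z : X}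
    {i j : ℕ} (hz : G.dist x z = i + 1) (h0 : j ≠ i) (h1 : j ≠ i + 1) (h2 : j ≠ i + 2) :
    G.sphereSum v j z = 0 := by
  rw [sphereSum, hv.distMatrix_mulVec_apply hc _ hz]
  simp [h0.symm, h1.symm, h2.symm]

theorem sphereSum_self (hv : G.IsLocalVector x v) (j : ℕ) : G.sphereSum v j x = 0 := by
  by_cases hj : j = 1
  · subst hj
    rw [← hv.sum_eq]
    refine Finset.sum_congr rfl fun y _ => ?_
    by_cases hy : G.dist x y = 1
    · simp [hy]
    · simp [hv.support y hy]
  · refine Finset.sum_eq_zero fun y _ => ?_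
    by_cases hy : G.dist x y = 1
    · simp [hy, Ne.symm hj]
    · simp [hv.support y hy]

theorem sphereSum_add (hv : G.IsLocalVector x v) (hc : G.Connected) {z : X}
    {i : ℕ} (hz : G.dist x z = i + 1) : G.sphereSum v i z + G.sphereSum v (i + 1) z +
      G.sphereSum v (i + 2) z = 0 := by
  have h1 := hv.distMatrix_mulVec_apply hc (fun _ => 1) hz
  have h2 : (G.distMatrix (fun _ => (1 : ℂ))).mulVec v z = 0 := by
    rw [← hv.sum_eq]
    simp [Matrix.mulVec, dotProduct]
  rw [h2] at h1
  linear_combination -h1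

theorem ladderVec_support (s : ℕ → ℝ) (r : ℕ) (y : X) (h : G.dist x y ≠ r) :
    G.ladderVec x s v r y = 0 := by
  rcases r with _ | r
  · rfl
  · simp [ladderVec, h]

theorem sphereSum_zero (hc : G.Connected) : G.sphereSum v 0 = v := by
  rw [sphereSum, distMatrix_single_zero hc, Matrix.one_mulVec]

theorem ladderVec_one (hv : G.IsLocalVector x v) (hc : G.Connected) {s : ℕ → ℝ} (hs : s 1 = 1) :
    G.ladderVec x s v 1 = v := by
  ext y
  by_cases hy : G.dist x y = 1
  · simp [ladderVec, hy, hs, sphereSum_zero hc]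
  · simp [ladderVec, hy, hv.support y hy]

/-- A sphere sum lives on three consecutive spheres around `x`; on them it is the `s`, `t` or `q`
multiple of the ladder vector. -/
theorem sphereSum_succ (hv : G.IsLocalVector x v) (hc : G.Connected) {s t q : ℕ → ℝ} {r : ℕ}
    (hs : ∀ i, s (i + 1) ≠ 0)
    (h1 : ∀ z i, G.dist x z = i + 1 →
      G.sphereSum v (i + 1) z = t (i + 1) * G.ladderVec x s v (i + 1) z)
    (h2 : ∀ z i, G.dist x z = i + 1 →
      G.sphereSum v (i + 2) z = q (i + 1) * G.ladderVec x s v (i + 1) z) (z : X) :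
    G.sphereSum v (r + 1) z = s (r + 2) * G.ladderVec x s v (r + 2) z +
      t (r + 1) * G.ladderVec x s v (r + 1) z + q r * G.ladderVec x s v r z := by
  rcases hz : G.dist x z with _ | l
  · have : z = x := (hc.dist_eq_zero_iff.1 hz).symm
    subst this
    rw [hv.sphereSum_self, ladderVec_support _ _ _ (by omega), ladderVec_support _ _ _ (by omega)]
    rcases r with _ | r
    · simp [ladderVec]
    · rw [ladderVec_support _ _ _ (by omega)]
      simp
  · by_cases e0 : r + 1 = l
    · subst e0
      rw [ladderVec_support _ (r + 1) _ (by omega), ladderVec_support _ r _ (by omega)]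
      have : ((s (r + 2) : ℝ) : ℂ) ≠ 0 := by exact_mod_cast hs (r + 1)
      simp [ladderVec, hz, mul_inv_cancel_left₀ this]
    · by_cases e1 : r = l
      · subst e1
        rw [ladderVec_support _ (r + 2) _ (by omega), ladderVec_support _ r _ (by omega), h1 z r hz]
        simp
      · by_cases e2 : r = l + 1
        · subst e2
          rw [ladderVec_support _ _ _ (by omega), ladderVec_support _ (l + 1 + 1) _ (by omega),
            h2 z l hz]
          simp
        · rw [hv.sphereSum_eq_zero hc hz (by omega) (by omega) (by omega),
            ladderVec_support _ _ _ (by omega), ladderVec_support _ _ _ (by omega),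
            ladderVec_support _ _ _ (by omega)]
          simp

theorem cAdj_mulVec_sphereSum_zero (h : G.NeighborCounts c a b) :
    G.cAdj.mulVec (G.sphereSum v 0) = (c 1 : ℂ) • G.sphereSum v 1 := by
  rw [sphereSum, sphereSum, Matrix.mulVec_mulVec, cAdj, h.adjMatrix_mul_sphere_zero,
    Matrix.smul_mulVec]

theorem cAdj_mulVec_sphereSum_succ (h : G.NeighborCounts c a b) (j : ℕ) :
    G.cAdj.mulVec (G.sphereSum v (j + 1)) = (b j : ℂ) • G.sphereSum v j +
      (a (j + 1) : ℂ) • G.sphereSum v (j + 1) + (c (j + 2) : ℂ) • G.sphereSum v (j + 2) := by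
  simp only [sphereSum]
  rw [Matrix.mulVec_mulVec, cAdj, h.adjMatrix_mul_sphere_succ]
  simp only [Matrix.add_mulVec, Matrix.smul_mulVec]

/-- If the sphere sums of a local vector are proportional on each sphere around `x`, with suitable
factors, they form a ladder. -/
theorem isLadder (hv : G.IsLocalVector x v) (h : G.NeighborCounts c a b)
    {s t q up flat down : ℕ → ℝ} {D : ℕ} (hD : 2 ≤ D) (hs : ∀ i, s (i + 1) ≠ 0)
    (h1 : ∀ z i, G.dist x z = i + 1 →
      G.sphereSum v (i + 1) z = t (i + 1) * G.ladderVec x s v (i + 1) z)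
    (h2 : ∀ z i, G.dist x z = i + 1 →
      G.sphereSum v (i + 2) z = q (i + 1) * G.ladderVec x s v (i + 1) z)
    (htop : G.ladderVec x s v D = 0)
    (hc1 : c 1 = 1) (hup : ∀ r < D, s r * up r = c r * s (r + 1)) (hs1 : s 1 * flat 1 = t 1)
    (hflat : ∀ r, r + 2 < D →
      s (r + 2) * flat (r + 2) = a (r + 1) * s (r + 2) + c (r + 2) * t (r + 2) -
        t (r + 1) * up (r + 1))
    (hdown : ∀ r, r + 2 < D →
      s (r + 2) * down (r + 2) = b r * s (r + 1) + a (r + 1) * t (r + 1) + c (r + 2) * q (r + 1) -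
        t (r + 1) * flat (r + 1) - q r * up r)
    (hz1 : ∀ r, r + 3 < D →
      b (r + 1) * t (r + 1) + a (r + 2) * q (r + 1) = t (r + 2) * down (r + 2) +
        q (r + 1) * flat (r + 1))
    (hz2 : ∀ r, r + 3 < D → b (r + 1) * q r = q (r + 1) * down (r + 1))
    (hup0 : up 0 = 0) :
    G.IsLadder x D up flat down (G.ladderVec x s v) := by
  refine ⟨rfl, htop, fun r y => ladderVec_support s r y, ?_⟩
  set w := G.ladderVec x s v with hw
  have hw0 : w 0 = 0 := rfl
  have hp : ∀ r z, G.sphereSum v (r + 1) z = s (r + 2) * w (r + 2) z + t (r + 1) * w (r + 1) z +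
      q r * w r z := fun r z => hv.sphereSum_succ h.connected hs h1 h2 z
  have hp0 : ∀ z, G.sphereSum v 0 z = s 1 * w 1 z := by
    intro z
    have : ((s 1 : ℝ) : ℂ) ≠ 0 := by exact_mod_cast hs 0
    rw [sphereSum_zero h.connected, hw]
    by_cases hz : G.dist x z = 1
    · simp [ladderVec, hz, mul_inv_cancel_left₀ this, sphereSum_zero h.connected]
    · simp [ladderVec, hz, hv.support z hz]
  have hAp : ∀ r, G.cAdj.mulVec (G.sphereSum v (r + 1)) = (s (r + 2) : ℂ) • G.cAdj.mulVec (w (r + 2)) +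
      (t (r + 1) : ℂ) • G.cAdj.mulVec (w (r + 1)) + (q r : ℂ) • G.cAdj.mulVec (w r) := by
    intro r
    rw [show G.sphereSum v (r + 1) = (s (r + 2) : ℂ) • w (r + 2) + (t (r + 1) : ℂ) • w (r + 1) +
      (q r : ℂ) • w r from funext (hp r)]
    simp only [Matrix.mulVec_add, Matrix.mulVec_smul]
  have base : G.cAdj.mulVec (w 1) = (up 1 : ℂ) • w 2 + (flat 1 : ℂ) • w 1 + (down 1 : ℂ) • w 0 := by
    have e1 := cAdj_mulVec_sphereSum_zero h (v := v)
    rw [show G.sphereSum v 0 = (s 1 : ℂ) • w 1 from funext hp0, Matrix.mulVec_smul, hc1] at e1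
    have hs1' : ((s 1 : ℝ) : ℂ) ≠ 0 := by exact_mod_cast hs 0
    ext z
    have e2 := congrFun e1 z
    have e3 := hp 0 z
    have u1 : ((s 1 * up 1 : ℝ) : ℂ) = ((c 1 * s 2 : ℝ) : ℂ) := by rw [hup 1 (by omega)]
    have u2 : ((s 1 * flat 1 : ℝ) : ℂ) = ((t 1 : ℝ) : ℂ) := by rw [hs1]
    rw [hc1] at u1
    push_cast at u1 u2
    simp only [Pi.smul_apply, smul_eq_mul, Pi.add_apply, hw0, Pi.zero_apply] at e2 e3 ⊢
    push_cast at e2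
    apply mul_left_cancel₀ hs1'
    linear_combination e2 + e3 - w 2 z * u1 - w 1 z * u2
  -- Apply A to the expansion of a sphere sum in three ladder vectors, rewrite the left side by the
  -- three-term recurrence, and solve for the image of the highest vector. `hup`, `hflat`, `hdown`
  -- give its coefficients; `hz1` and `hz2` cancel the two lower terms.
  suffices H : ∀ r, (r + 1 < D → G.cAdj.mulVec (w (r + 1)) =
      (up (r + 1) : ℂ) • w (r + 2) + (flat (r + 1) : ℂ) • w (r + 1) + (down (r + 1) : ℂ) • w r) ∧
      (r + 2 < D → G.cAdj.mulVec (w (r + 2)) =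
      (up (r + 2) : ℂ) • w (r + 3) + (flat (r + 2) : ℂ) • w (r + 2) +
        (down (r + 2) : ℂ) • w (r + 1)) from fun r => (H r).1
  intro r
  induction r with
  | zero =>
    refine ⟨fun _ => base, fun hr => ?_⟩
    have e1 := hAp 0
    rw [cAdj_mulVec_sphereSum_succ h, base, hw0, Matrix.mulVec_zero] at e1
    have hs' : ((s 2 : ℝ) : ℂ) ≠ 0 := by exact_mod_cast hs 1
    ext z
    have e2 := congrFun e1 z
    have e3 := hp 0 z
    have e4 := hp 1 z
    have e5 := hp0 z
    have u1 : ((s 2 * up 2 : ℝ) : ℂ) = ((c 2 * s 3 : ℝ) : ℂ) := by rw [hup 2 (by omega)]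
    have u2 := congrArg (fun y : ℝ => (y : ℂ)) (hflat 0 hr)
    have u3 := congrArg (fun y : ℝ => (y : ℂ)) (hdown 0 hr)
    rw [hup0] at u3
    push_cast at u1 u2 u3
    simp only [Pi.smul_apply, smul_eq_mul, Pi.add_apply, hw0, Pi.zero_apply, zero_add] at *
    rw [e3, e4, e5] at e2
    apply mul_left_cancel₀ hs'
    linear_combination -e2 - w 3 z * u1 - w 2 z * u2 - w 1 z * u3
  | succ r ih =>
    refine ⟨ih.2, fun hr => ?_⟩
    have e1 := hAp (r + 1)
    rw [cAdj_mulVec_sphereSum_succ h, ih.2 (by omega), ih.1 (by omega)] at e1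
    have hs' : ((s (r + 3) : ℝ) : ℂ) ≠ 0 := by exact_mod_cast hs (r + 2)
    ext z
    have e2 := congrFun e1 z
    have e3 := hp r z
    have e4 := hp (r + 1) z
    have e5 := hp (r + 2) z
    have u1 := congrArg (fun y : ℝ => (y : ℂ)) (hup (r + 3) hr)
    have u2 := congrArg (fun y : ℝ => (y : ℂ)) (hflat (r + 1) hr)
    have u3 := congrArg (fun y : ℝ => (y : ℂ)) (hdown (r + 1) hr)
    have u4 := congrArg (fun y : ℝ => (y : ℂ)) (hz1 r hr)
    have u5 := congrArg (fun y : ℝ => (y : ℂ)) (hz2 r hr)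
    push_cast at u1 u2 u3 u4 u5
    simp only [Pi.smul_apply, smul_eq_mul, Pi.add_apply] at e2 e3 e4 e5 ⊢
    rw [e3, e4, e5] at e2
    apply mul_left_cancel₀ hs'
    linear_combination -e2 - w (r + 4) z * u1 - w (r + 3) z * u2 - w (r + 2) z * u3 +
      w (r + 1) z * u4 + w r z * u5

end IsLocalVector

/-! ### The two kinds of local vectors -/

namespace HasUnitBaseArray

variable {G : SimpleGraph X} {D : ℕ} {α : ℝ} {c a b : ℕ → ℕ} {x : X} {v : X → ℂ}

/-- Raising coefficients of the ladders of the second largest eigenvalue. -/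
noncomputable def upSecond (α : ℝ) (r : ℕ) : ℝ := r * (1 + α * (r - 1))

/-- Flat coefficients of the ladders of the second largest eigenvalue. -/
noncomputable def flatSecond (D : ℕ) (α : ℝ) (r : ℕ) : ℝ :=
  2 * (1 + α * (D - 1)) * (r - 1) - 2 * (r * (1 + α * (r - 1)))

/-- Lowering coefficients of the ladders of the second largest eigenvalue. -/
noncomputable def downSecond (D : ℕ) (α : ℝ) (r : ℕ) : ℝ := (D - r) * (1 + α * (D - 1 - r))

/-- Raising coefficients of the ladders of the least eigenvalue. -/
noncomputable def upLeast (α : ℝ) (r : ℕ) : ℝ := r * (1 + α * r)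

/-- Flat coefficients of the ladders of the least eigenvalue. -/
noncomputable def flatLeast (D : ℕ) (α : ℝ) (r : ℕ) : ℝ := α * (2 * r * (D - r) - D)

/-- Lowering coefficients of the ladders of the least eigenvalue. -/
noncomputable def downLeast (D : ℕ) (α : ℝ) (r : ℕ) : ℝ := (D - r) * (1 + α * (D - r))

/-- Subtracting u_{i+1} times the zero-sum relation from the kernel relation eliminates the middle
sphere sum. -/
theorem sphereSum_relation (h : G.HasUnitBaseArray D α (1 + α * (D - 1)) c a b)
    (hv : G.IsLocalVector x v) {u : ℕ → ℝ} (hu : (G.cDistMatrix u).mulVec v = 0) {z : X} {i : ℕ}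
    (hz : G.dist x z = i + 1) :
    ((u i - u (i + 1) : ℝ) : ℂ) * G.sphereSum v i z =
      ((u (i + 1) - u (i + 2) : ℝ) : ℂ) * G.sphereSum v (i + 2) z := by
  have h1 := hv.distMatrix_mulVec_apply h.counts.connected (fun i => (u i : ℂ)) hz
  rw [hu] at h1
  have h2 := hv.sphereSum_add h.counts.connected hz
  push_cast
  simp only [Pi.zero_apply] at h1
  linear_combination -h1 - (u (i + 1) : ℂ) * h2

theorem sphereSum_top (h : G.HasUnitBaseArray D α (1 + α * (D - 1)) c a b) (z : X) {i : ℕ}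
    (hi : D < i) : G.sphereSum v i z = 0 := by
  refine Finset.sum_eq_zero fun y _ => ?_
  have := dist_le_diam_of_connected h.counts.connected z y
  have := h.diam_eq
  simp [show G.dist z y ≠ i by omega]

theorem dist_le (h : G.HasUnitBaseArray D α (1 + α * (D - 1)) c a b) (y z : X) :
    G.dist y z ≤ D :=
  h.diam_eq ▸ dist_le_diam_of_connected h.counts.connected y z

theorem c_one (h : G.HasUnitBaseArray D α (1 + α * (D - 1)) c a b) : c 1 = 1 := by
  have := h.c_eq 1 (by have := h.three_le; omega)
  push_cast at this
  have h1 : (c 1 : ℝ) = 1 := by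
    rw [this]
    ring
  exact_mod_cast h1

/-- `linSeq` has constant differences, so the outer two sphere sums agree and the middle one is -2
times either. On the last sphere one of the outer two is empty, which makes the ladder stop at D -
1. -/
theorem isLadder_second (h : G.HasUnitBaseArray D α (1 + α * (D - 1)) c a b)
    (hv : G.IsLocalVector x v) (hu : (G.cDistMatrix (linSeq D)).mulVec v = 0) :
    G.IsLadder x D (upSecond α) (flatSecond D α) (downSecond D α)
      (G.ladderVec x (fun _ => 1) v) := by
  have hD := h.three_le
  have key : ∀ z i, G.dist x z = i + 1 → G.sphereSum v (i + 2) z = G.sphereSum v i z := by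
    intro z i hz
    have h1 := h.sphereSum_relation hv hu hz
    simp only [linSeq] at h1
    push_cast at h1
    linear_combination -(1 / 2 : ℂ) * h1
  have hw : ∀ z i, G.dist x z = i + 1 →
      G.ladderVec x (fun _ => 1) v (i + 1) z = G.sphereSum v i z := by
    intro z i hz
    simp [ladderVec, hz]
  refine hv.isLadder h.counts (t := fun _ => -2) (q := fun _ => 1) (by omega)
    (fun _ => one_ne_zero) ?_ ?_ ?_ h.c_one ?_ ?_ ?_ ?_ ?_ ?_ ?_
  · intro z i hz
    rw [hw z i hz]
    have h1 := hv.sphereSum_add h.counts.connected hz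
    rw [key z i hz] at h1
    push_cast
    linear_combination h1
  · intro z i hz
    rw [hw z i hz, key z i hz]
    simp
  · ext z
    obtain ⟨n, rfl⟩ : ∃ n, D = n + 1 := ⟨D - 1, by omega⟩
    by_cases hz : G.dist x z = n + 1
    · rw [hw z n hz, ← key z n hz, h.sphereSum_top z (by omega)]
      rfl
    · exact IsLocalVector.ladderVec_support _ _ _ hz
  · intro r hr
    rw [h.c_eq r hr.le, upSecond]
    ring
  · simp [flatSecond]
  · intro r hr
    rw [h.c_eq _ (by omega), h.a_eq (i := r + 1) (by omega), flatSecond, upSecond]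
    push_cast
    ring
  · intro r hr
    rw [h.c_eq _ (by omega), h.a_eq (i := r + 1) (by omega), h.b_eq r (by omega), flatSecond,
      upSecond, downSecond]
    push_cast
    ring
  · intro r hr
    rw [h.a_eq (i := r + 2) (by omega), h.b_eq (r + 1) (by omega), flatSecond, downSecond]
    push_cast
    ring
  · intro r hr
    rw [h.b_eq (r + 1) (by omega), downSecond]
    push_cast
    ring
  · simp [upSecond]

/-- On the sphere of radius r the three sphere sums are in ratio 1 + α(r - 1) : α(D - 2r) : -(1 +
α(D - 1 - r)). Dividing by the first entry makes all ladder coefficients polynomial. -/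
theorem isLadder_least (h : G.HasUnitBaseArray D α (1 + α * (D - 1)) c a b)
    (hv : G.IsLocalVector x v)
    (hu : (G.cDistMatrix (leastSeq α (1 + α * (D - 1)))).mulVec v = 0) :
    G.IsLadder x D (upLeast α) (flatLeast D α) (downLeast D α)
      (G.ladderVec x (fun r => 1 + α * (r - 1)) v) := by
  have hD := h.three_le
  have hα := h.alpha_nonneg
  have hs : ∀ i : ℕ, 1 + α * (((i + 1 : ℕ) : ℝ) - 1) ≠ 0 := by
    intro i
    push_cast
    rw [add_sub_cancel_right]
    exact (h.one_add_pos i).ne'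
  have hs' : ∀ i : ℕ, ((1 + α * (((i + 1 : ℕ) : ℝ) - 1) : ℝ) : ℂ) ≠ 0 := by
    intro i
    exact_mod_cast hs i
  have hw : ∀ z i, G.dist x z = i + 1 →
      ((1 + α * (((i + 1 : ℕ) : ℝ) - 1) : ℝ) : ℂ) *
        G.ladderVec x (fun r => 1 + α * (r - 1)) v (i + 1) z = G.sphereSum v i z := by
    intro z i hz
    simp only [ladderVec, hz, if_true]
    rw [mul_inv_cancel_left₀ (hs' i)]
  -- On the last sphere the outer sum is empty, and consecutive values of `leastSeq` differ, so the
  -- inner sum vanishes too.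
  have top : ∀ z i, G.dist x z = i + 1 → i + 1 = D → G.sphereSum v i z = 0 := by
    intro z i hz hi
    have h1 := h.sphereSum_relation hv hu hz
    rw [h.sphereSum_top z (by omega : D < i + 2), mul_zero] at h1
    refine (mul_eq_zero.1 h1).resolve_left ?_
    have e1 := h.leastSeq_succ (i := i) (by omega)
    have p1 := h.pos_of_lt (i := i) (by omega)
    have p2 := h.one_add_pos i
    have p3 := h.leastSeq_ne_zero (i := i) (by omega)
    intro h0
    have h0' : leastSeq α (1 + α * (D - 1)) i - leastSeq α (1 + α * (D - 1)) (i + 1) = 0 := by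
      exact_mod_cast h0
    have : ((1 + α * (D - 1 - i)) + (1 + α * i)) * leastSeq α (1 + α * (D - 1)) i = 0 := by
      linear_combination (1 + α * (D - 1 - i)) * h0' + e1
    exact mul_ne_zero (by positivity) p3 this
  have key : ∀ z i, G.dist x z = i + 1 →
      ((1 + α * i : ℝ) : ℂ) * G.sphereSum v (i + 2) z =
        -((1 + α * (D - 2 - i) : ℝ) : ℂ) * G.sphereSum v i z := by
    intro z i hz
    have hle := h.dist_le x z
    rcases (by omega : i + 1 = D ∨ i + 1 < D) with hi | hi
    · rw [top z i hz hi, h.sphereSum_top z (by omega : D < i + 2)]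
      simp
    · have h1 := h.sphereSum_relation hv hu hz
      have e1 := h.leastSeq_succ (i := i) (by omega)
      have e2 := h.leastSeq_succ (i := i + 1) hi
      have p1 := h.pos_of_lt (i := i) (by omega)
      have p3 := h.leastSeq_ne_zero (i := i) (by omega)
      have p4 : (1 : ℝ) + α * i + (1 + α * (D - 1 - i)) ≠ 0 := by
        have := h.one_add_pos i
        positivity
      set u0 := leastSeq α (1 + α * (D - 1)) i
      set u1 := leastSeq α (1 + α * (D - 1)) (i + 1)
      set u2 := leastSeq α (1 + α * (D - 1)) (i + 2)
      -- After clearing denominators both differences of `leastSeq` contain the same nonzero factor,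
      -- which cancels.
      have f1 : (1 + α * (D - 1 - i)) * (u0 - u1) =
          (1 + α * i + (1 + α * (D - 1 - i))) * u0 := by
        linear_combination -e1
      have f2 : (1 + α * (D - 2 - i)) * ((1 + α * (D - 1 - i)) * (u1 - u2)) =
          -((1 + α * i + (1 + α * (D - 1 - i))) * u0 * (1 + α * i)) := by
        push_cast at e2
        linear_combination -(1 + α * (D - 1 - i)) * e2 +
          (1 + α * (D - 2 - i) + (1 + α * (i + 1))) * e1
      have hne : ((((1 + α * i + (1 + α * (D - 1 - i))) * u0 : ℝ)) : ℂ) ≠ 0 := by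
        exact_mod_cast mul_ne_zero p4 p3
      apply mul_left_cancel₀ hne
      have f1' := congrArg (fun y : ℝ => (y : ℂ)) f1
      have f2' := congrArg (fun y : ℝ => (y : ℂ)) f2
      push_cast at f1' f2' h1 ⊢
      linear_combination G.sphereSum v (i + 2) z * f2' - (1 + α * (D - 2 - i) : ℂ) *
        G.sphereSum v i z * f1' + (1 + α * (D - 2 - i) : ℂ) * (1 + α * (D - 1 - i) : ℂ) * h1
  have hq : ∀ z i, G.dist x z = i + 1 → G.sphereSum v (i + 2) z =
      ((-(1 + α * (D - 1 - ((i + 1 : ℕ) : ℝ))) : ℝ) : ℂ) *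
        G.ladderVec x (fun r => 1 + α * (r - 1)) v (i + 1) z := by
    intro z i hz
    have h1 := key z i hz
    have h2 := hw z i hz
    rw [← h2] at h1
    have hne := hs' i
    push_cast at h1 h2 hne ⊢
    rw [add_sub_cancel_right] at hne
    apply mul_left_cancel₀ hne
    linear_combination h1
  refine hv.isLadder h.counts (t := fun r => α * (D - 2 * r))
    (q := fun r => -(1 + α * (D - 1 - r))) (by omega) hs ?_ hq ?_ h.c_one ?_ ?_ ?_ ?_ ?_ ?_ ?_
  · intro z i hz
    have h1 := hv.sphereSum_add h.counts.connected hz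
    rw [hq z i hz, ← hw z i hz] at h1
    push_cast at h1 ⊢
    linear_combination h1
  · ext z
    obtain ⟨n, rfl⟩ : ∃ n, D = n + 1 := ⟨D - 1, by omega⟩
    by_cases hz : G.dist x z = n + 1
    · simp [ladderVec, top z n hz rfl]
    · exact IsLocalVector.ladderVec_support _ _ _ hz
  · intro r hr
    rw [h.c_eq r hr.le, upLeast]
    push_cast
    ring
  · simp only [flatLeast]
    push_cast
    ring
  · intro r hr
    rw [h.c_eq _ (by omega), h.a_eq (i := r + 1) (by omega), flatLeast, upLeast]
    push_cast
    ring
  · intro r hr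
    rw [h.c_eq _ (by omega), h.a_eq (i := r + 1) (by omega), h.b_eq r (by omega), flatLeast,
      upLeast, downLeast]
    push_cast
    ring
  · intro r hr
    rw [h.a_eq (i := r + 2) (by omega), h.b_eq (r + 1) (by omega), flatLeast, downLeast]
    push_cast
    ring
  · intro r hr
    rw [h.b_eq (r + 1) (by omega), downLeast]
    push_cast
    ring
  · simp [upLeast]

end HasUnitBaseArray

/-! ### The module spanned by a ladder -/

/-- A ladder that starts at a nonzero vector and can be climbed in both directions. -/
structure IsProperLadder (G : SimpleGraph X) (x : X) (D : ℕ) (up flat down : ℕ → ℝ)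
    (w : ℕ → X → ℂ) : Prop extends G.IsLadder x D up flat down w where
  one_lt : 1 < D
  one_ne_zero : w 1 ≠ 0
  up_ne_zero : ∀ r, r + 2 < D → up (r + 1) ≠ 0
  down_ne_zero : ∀ r, r + 2 < D → down (r + 2) ≠ 0

/-- The span of the nonzero vectors of a ladder. -/
noncomputable def ladderSpan (D : ℕ) (w : ℕ → X → ℂ) : Submodule ℂ (X → ℂ) :=
  Submodule.span ℂ (w '' Set.Ico 1 D)

/-- The graph of the isomorphism between the modules spanned by two ladders. -/
noncomputable def ladderGraph (D : ℕ) (w w' : ℕ → X → ℂ) :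
    Submodule ℂ ((X → ℂ) × (X → ℂ)) :=
  Submodule.span ℂ ((fun r => (w r, w' r)) '' Set.Ico 1 D)

theorem map_fst_ladderGraph (D : ℕ) (w w' : ℕ → X → ℂ) :
    (ladderGraph D w w').map (LinearMap.fst ℂ (X → ℂ) (X → ℂ)) = ladderSpan D w := by
  rw [ladderGraph, Submodule.map_span, Set.image_image]
  rfl

theorem map_snd_ladderGraph (D : ℕ) (w w' : ℕ → X → ℂ) :
    (ladderGraph D w w').map (LinearMap.snd ℂ (X → ℂ) (X → ℂ)) = ladderSpan D w' := by
  rw [ladderGraph, Submodule.map_span, Set.image_image]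
  rfl

theorem exists_mem_ladderGraph {D : ℕ} {w : ℕ → X → ℂ} (w' : ℕ → X → ℂ) {f : X → ℂ}
    (hf : f ∈ ladderSpan D w) : ∃ g, (f, g) ∈ ladderGraph D w w' := by
  rw [← map_fst_ladderGraph D w w'] at hf
  obtain ⟨⟨f', g⟩, h, rfl⟩ := hf
  exact ⟨g, h⟩

theorem exists_mem_ladderGraph' {D : ℕ} (w : ℕ → X → ℂ) {w' : ℕ → X → ℂ} {g : X → ℂ}
    (hg : g ∈ ladderSpan D w') : ∃ f, (f, g) ∈ ladderGraph D w w' := by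
  rw [← map_snd_ladderGraph D w w'] at hg
  obtain ⟨⟨f, g'⟩, h, rfl⟩ := hg
  exact ⟨f, h⟩

theorem fst_mem_of_mem_ladderGraph {D : ℕ} {w w' : ℕ → X → ℂ} {q : (X → ℂ) × (X → ℂ)}
    (hq : q ∈ ladderGraph D w w') : q.1 ∈ ladderSpan D w := by
  rw [← map_fst_ladderGraph D w w']
  exact ⟨q, hq, rfl⟩

theorem snd_mem_of_mem_ladderGraph {D : ℕ} {w w' : ℕ → X → ℂ} {q : (X → ℂ) × (X → ℂ)}
    (hq : q ∈ ladderGraph D w w') : q.2 ∈ ladderSpan D w' := by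
  rw [← map_snd_ladderGraph D w w']
  exact ⟨q, hq, rfl⟩

theorem mem_ladderSpan {D : ℕ} (w : ℕ → X → ℂ) {r : ℕ} (h1 : 1 ≤ r) (h2 : r < D) :
    w r ∈ ladderSpan D w :=
  Submodule.subset_span ⟨r, ⟨h1, h2⟩, rfl⟩

theorem mem_ladderGraph {D : ℕ} (w w' : ℕ → X → ℂ) {r : ℕ} (h1 : 1 ≤ r) (h2 : r < D) :
    (w r, w' r) ∈ ladderGraph D w w' :=
  Submodule.subset_span ⟨r, ⟨h1, h2⟩, rfl⟩

theorem dualIdempotent_mulVec_eq (G : SimpleGraph X) {x : X} {f : X → ℂ} {r : ℕ}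
    (hf : ∀ y, G.dist x y ≠ r → f y = 0) (i : ℕ) :
    (G.dualIdempotent x i).mulVec f = if r = i then f else 0 := by
  ext y
  rw [dualIdempotent_mulVec]
  by_cases h : r = i
  · subst h
    simp only [if_true]
    split_ifs with h1
    · rfl
    · exact (hf y h1).symm
  · simp only [h, if_false, Pi.zero_apply]
    split_ifs with h1
    · exact hf y (by omega)
    · rfl

theorem dualIdempotent_mem (G : SimpleGraph X) (x : X) (i : ℕ) :
    G.dualIdempotent x i ∈ G.terwilligerAlgebra x :=
  Algebra.subset_adjoin (Set.mem_insert_of_mem _ ⟨i, rfl⟩)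

theorem cAdj_mem (G : SimpleGraph X) (x : X) : G.cAdj ∈ G.terwilligerAlgebra x :=
  Algebra.subset_adjoin (Set.mem_insert _ _)

theorem eq_zero_of_dualIdempotent_mulVec {G : SimpleGraph X} {x : X} {f : X → ℂ}
    (h : ∀ i, (G.dualIdempotent x i).mulVec f = 0) : f = 0 := by
  ext y
  have := congrFun (h (G.dist x y)) y
  rwa [dualIdempotent_mulVec, if_pos rfl] at this

namespace IsLadder

variable {G : SimpleGraph X} {x : X} {D : ℕ} {up flat down : ℕ → ℝ} {w w' : ℕ → X → ℂ}

theorem dualIdempotent_mulVec (h : G.IsLadder x D up flat down w) (r i : ℕ) :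
    (G.dualIdempotent x i).mulVec (w r) = if r = i then w r else 0 :=
  dualIdempotent_mulVec_eq G (h.support r) i

theorem cAdj_graph_mem (h : G.IsLadder x D up flat down w) (h' : G.IsLadder x D up flat down w')
    {q : (X → ℂ) × (X → ℂ)} (hq : q ∈ ladderGraph D w w') :
    (G.cAdj.mulVec q.1, G.cAdj.mulVec q.2) ∈ ladderGraph D w w' := by
  have hmem : ∀ r ≤ D, (w r, w' r) ∈ ladderGraph D w w' := by
    intro r hr
    rcases Nat.eq_zero_or_pos r with rfl | h1
    · rw [h.zero, h'.zero]
      exact zero_mem _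
    · rcases hr.lt_or_eq with h2 | rfl
      · exact mem_ladderGraph w w' h1 h2
      · rw [h.top, h'.top]
        exact zero_mem _
  induction hq using Submodule.span_induction with
  | mem q hq =>
    obtain ⟨r, ⟨h1, h2⟩, rfl⟩ := hq
    obtain ⟨r, rfl⟩ : ∃ n, r = n + 1 := ⟨r - 1, by omega⟩
    simp only [h.cAdj_mulVec r h2, h'.cAdj_mulVec r h2]
    exact add_mem (add_mem (Submodule.smul_mem _ (up (r + 1) : ℂ) (hmem (r + 2) (by omega)))
      (Submodule.smul_mem _ (flat (r + 1) : ℂ) (hmem (r + 1) (by omega))))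
      (Submodule.smul_mem _ (down (r + 1) : ℂ) (hmem r (by omega)))
  | zero =>
    simp only [Prod.fst_zero, Prod.snd_zero, Matrix.mulVec_zero]
    exact zero_mem _
  | add q q' _ _ hq hq' =>
    simp only [Prod.fst_add, Prod.snd_add, Matrix.mulVec_add]
    exact add_mem hq hq'
  | smul t q _ hq =>
    simp only [Prod.smul_fst, Prod.smul_snd, Matrix.mulVec_smul]
    exact Submodule.smul_mem _ t hq

theorem exists_dualIdempotent_graph (h : G.IsLadder x D up flat down w)
    (h' : G.IsLadder x D up flat down w') {q : (X → ℂ) × (X → ℂ)} (hq : q ∈ ladderGraph D w w')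
    (i : ℕ) : ∃ t : ℂ, (¬ (1 ≤ i ∧ i < D) → t = 0) ∧ (G.dualIdempotent x i).mulVec q.1 = t • w i ∧
      (G.dualIdempotent x i).mulVec q.2 = t • w' i := by
  induction hq using Submodule.span_induction with
  | mem q hq =>
    obtain ⟨r, ⟨h1, h2⟩, rfl⟩ := hq
    simp only [h.dualIdempotent_mulVec, h'.dualIdempotent_mulVec]
    by_cases hr : r = i
    · subst hr
      exact ⟨1, fun h3 => absurd ⟨h1, h2⟩ h3, by simp⟩
    · exact ⟨0, by simp [hr]⟩
  | zero => exact ⟨0, by simp⟩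
  | add q q' _ _ hq hq' =>
    obtain ⟨t, h1, h2, h3⟩ := hq
    obtain ⟨t', h1', h2', h3'⟩ := hq'
    refine ⟨t + t', fun h4 => by rw [h1 h4, h1' h4, add_zero], ?_, ?_⟩
    · rw [Prod.fst_add, Matrix.mulVec_add, h2, h2', add_smul]
    · rw [Prod.snd_add, Matrix.mulVec_add, h3, h3', add_smul]
  | smul t q _ hq =>
    obtain ⟨t', h1, h2, h3⟩ := hq
    refine ⟨t * t', fun h4 => by rw [h1 h4, mul_zero], ?_, ?_⟩
    · rw [Prod.smul_fst, Matrix.mulVec_smul, h2, mul_smul]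
    · rw [Prod.smul_snd, Matrix.mulVec_smul, h3, mul_smul]

theorem exists_dualIdempotent (h : G.IsLadder x D up flat down w) {f : X → ℂ}
    (hf : f ∈ ladderSpan D w) (i : ℕ) :
    ∃ t : ℂ, (¬ (1 ≤ i ∧ i < D) → t = 0) ∧ (G.dualIdempotent x i).mulVec f = t • w i := by
  obtain ⟨g, hg⟩ := exists_mem_ladderGraph w hf
  obtain ⟨t, h1, h2, -⟩ := h.exists_dualIdempotent_graph h hg i
  exact ⟨t, h1, h2⟩

/-- Equal coefficients make each generator act on both ladders simultaneously. Taking `w' = w`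
yields invariance of the span itself. -/
theorem graph_mem (h : G.IsLadder x D up flat down w) (h' : G.IsLadder x D up flat down w')
    {B : Matrix X X ℂ} (hB : B ∈ G.terwilligerAlgebra x) :
    ∀ q ∈ ladderGraph D w w', (B.mulVec q.1, B.mulVec q.2) ∈ ladderGraph D w w' := by
  induction hB using Algebra.adjoin_induction with
  | mem B hB =>
    intro q hq
    rcases hB with rfl | ⟨i, rfl⟩
    · exact h.cAdj_graph_mem h' hq
    · obtain ⟨t, h1, h2, h3⟩ := h.exists_dualIdempotent_graph h' hq i
      rw [h2, h3]
      by_cases hi : 1 ≤ i ∧ i < D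
      · exact Submodule.smul_mem _ t (mem_ladderGraph w w' hi.1 hi.2)
      · rw [h1 hi, zero_smul, zero_smul]
        exact zero_mem _
  | algebraMap t =>
    intro q hq
    simp only [Algebra.algebraMap_eq_smul_one, Matrix.smul_mulVec, Matrix.one_mulVec]
    exact Submodule.smul_mem _ t hq
  | add B B' _ _ hB hB' =>
    intro q hq
    simp only [Matrix.add_mulVec]
    exact add_mem (hB q hq) (hB' q hq)
  | mul B B' _ _ hB hB' =>
    intro q hq
    simp only [← Matrix.mulVec_mulVec]
    exact hB _ (hB' q hq)

theorem isTModule (h : G.IsLadder x D up flat down w) :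
    IsTModule (G.terwilligerAlgebra x) (ladderSpan D w) := by
  intro B hB f hf
  obtain ⟨g, hg⟩ := exists_mem_ladderGraph w hf
  exact fst_mem_of_mem_ladderGraph (h.graph_mem h hB _ hg)

theorem dualIdempotent_cAdj_up (h : G.IsLadder x D up flat down w) {r : ℕ} (hr : r + 1 < D) :
    (G.dualIdempotent x (r + 2)).mulVec (G.cAdj.mulVec (w (r + 1))) = (up (r + 1) : ℂ) • w (r + 2) := by
  rw [h.cAdj_mulVec r hr]
  simp [Matrix.mulVec_add, Matrix.mulVec_smul, h.dualIdempotent_mulVec]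

theorem dualIdempotent_cAdj_down (h : G.IsLadder x D up flat down w) {r : ℕ} (hr : r + 1 < D) :
    (G.dualIdempotent x r).mulVec (G.cAdj.mulVec (w (r + 1))) = (down (r + 1) : ℂ) • w r := by
  rw [h.cAdj_mulVec r hr]
  simp [Matrix.mulVec_add, Matrix.mulVec_smul, h.dualIdempotent_mulVec]

theorem dualIdempotent_cAdj_flat (h : G.IsLadder x D up flat down w) {r : ℕ} (hr : r + 1 < D) :
    (G.dualIdempotent x (r + 1)).mulVec (G.cAdj.mulVec (w (r + 1))) =
      (flat (r + 1) : ℂ) • w (r + 1) := by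
  rw [h.cAdj_mulVec r hr]
  simp [Matrix.mulVec_add, Matrix.mulVec_smul, h.dualIdempotent_mulVec]

end IsLadder

theorem flat_mulVec (G : SimpleGraph X) {x : X} {f : X → ℂ} {r : ℕ} (hr : r ≤ G.vertexEcc x)
    (hf : ∀ y, G.dist x y ≠ r → f y = 0) :
    (G.flat x).mulVec f = (G.dualIdempotent x r).mulVec (G.cAdj.mulVec f) := by
  rw [flat, Matrix.sum_mulVec, Finset.sum_eq_single r]
  · rw [← Matrix.mulVec_mulVec, ← Matrix.mulVec_mulVec, dualIdempotent_mulVec_eq G hf, if_pos rfl]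
  · intro i _ hi
    rw [← Matrix.mulVec_mulVec, dualIdempotent_mulVec_eq G hf, if_neg hi.symm, Matrix.mulVec_zero]
  · intro h
    simp only [Finset.mem_range] at h
    omega

theorem raising_mulVec (G : SimpleGraph X) {x : X} {f : X → ℂ} {r : ℕ} (hr : r < G.vertexEcc x)
    (hf : ∀ y, G.dist x y ≠ r → f y = 0) :
    (G.raising x).mulVec f = (G.dualIdempotent x (r + 1)).mulVec (G.cAdj.mulVec f) := by
  rw [raising, Matrix.sum_mulVec, Finset.sum_eq_single r]
  · rw [← Matrix.mulVec_mulVec, ← Matrix.mulVec_mulVec, dualIdempotent_mulVec_eq G hf, if_pos rfl]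
  · intro i _ hi
    rw [← Matrix.mulVec_mulVec, dualIdempotent_mulVec_eq G hf, if_neg hi.symm, Matrix.mulVec_zero]
  · intro h
    simp only [Finset.mem_range] at h
    omega

theorem lowering_mulVec (G : SimpleGraph X) {x : X} {f : X → ℂ} {r : ℕ}
    (hr : r + 1 ≤ G.vertexEcc x) (hf : ∀ y, G.dist x y ≠ r + 1 → f y = 0) :
    (G.lowering x).mulVec f = (G.dualIdempotent x r).mulVec (G.cAdj.mulVec f) := by
  rw [lowering, Matrix.sum_mulVec, Finset.sum_eq_single (r + 1)]
  · rw [← Matrix.mulVec_mulVec, ← Matrix.mulVec_mulVec, dualIdempotent_mulVec_eq G hf, if_pos rfl,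
      Nat.add_sub_cancel]
  · intro i _ hi
    rw [← Matrix.mulVec_mulVec, dualIdempotent_mulVec_eq G hf, if_neg hi.symm, Matrix.mulVec_zero]
  · intro h
    simp only [Finset.mem_Icc] at h
    omega

namespace IsProperLadder

variable {G : SimpleGraph X} {x : X} {D : ℕ} {up flat down : ℕ → ℝ} {w w' : ℕ → X → ℂ}

/-- Lowering leads back to `w 1` with nonzero coefficients. -/
theorem ne_zero (h : G.IsProperLadder x D up flat down w) {r : ℕ} (hr : r + 1 < D) :
    w (r + 1) ≠ 0 := by
  induction r with
  | zero => exact h.one_ne_zero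
  | succ r ih =>
    intro h0
    have h1 := h.dualIdempotent_cAdj_down hr
    rw [h0, Matrix.mulVec_zero, Matrix.mulVec_zero] at h1
    have h2 : ((down (r + 2) : ℝ) : ℂ) ≠ 0 := by exact_mod_cast h.down_ne_zero r hr
    exact ih (by omega) ((smul_eq_zero.1 h1.symm).resolve_left h2)

theorem ladderSpan_ne_bot (h : G.IsProperLadder x D up flat down w) : ladderSpan D w ≠ ⊥ :=
  fun h0 => h.one_ne_zero ((Submodule.eq_bot_iff _).1 h0 _ (mem_ladderSpan w le_rfl h.one_lt))

theorem ladderSpan_le (h : G.IsProperLadder x D up flat down w) {U : Submodule ℂ (X → ℂ)}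
    (hU : IsTModule (G.terwilligerAlgebra x) U) (h1 : w 1 ∈ U) : ladderSpan D w ≤ U := by
  have key : ∀ r, r + 1 < D → w (r + 1) ∈ U := by
    intro r
    induction r with
    | zero => exact fun _ => h1
    | succ r ih =>
      intro hr
      have h2 := hU _ (G.dualIdempotent_mem x (r + 2)) _ (hU _ (G.cAdj_mem x) _ (ih (by omega)))
      rw [h.dualIdempotent_cAdj_up (by omega)] at h2
      exact (U.smul_mem_iff (by exact_mod_cast h.up_ne_zero r hr)).1 h2
  rw [ladderSpan, Submodule.span_le]
  rintro _ ⟨r, ⟨hr1, hr2⟩, rfl⟩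
  obtain ⟨r, rfl⟩ : ∃ n, r = n + 1 := ⟨r - 1, by omega⟩
  exact key r hr2

theorem one_mem (h : G.IsProperLadder x D up flat down w) {U : Submodule ℂ (X → ℂ)}
    (hU : IsTModule (G.terwilligerAlgebra x) U) {r : ℕ} (hr : r + 1 < D) (h1 : w (r + 1) ∈ U) :
    w 1 ∈ U := by
  induction r with
  | zero => exact h1
  | succ r ih =>
    refine ih (by omega) ?_
    have h2 := hU _ (G.dualIdempotent_mem x (r + 1)) _ (hU _ (G.cAdj_mem x) _ h1)
    rw [h.dualIdempotent_cAdj_down hr] at h2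
    exact (U.smul_mem_iff (by exact_mod_cast h.down_ne_zero r hr)).1 h2

/-- A nonzero submodule contains some `w i` as a component of a nonzero vector; lowering reaches `w
1`, and raising recovers the whole span. -/
theorem isIrreducibleTModule (h : G.IsProperLadder x D up flat down w) :
    IsIrreducibleTModule (G.terwilligerAlgebra x) (ladderSpan D w) := by
  refine ⟨h.isTModule, h.ladderSpan_ne_bot, fun U hU hT => ?_⟩
  by_cases h0 : U = ⊥
  · exact Or.inl h0
  · refine Or.inr (le_antisymm hU (h.ladderSpan_le hT ?_))
    obtain ⟨f, hf, hne⟩ := U.ne_bot_iff.1 h0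
    obtain ⟨i, hi⟩ : ∃ i, (G.dualIdempotent x i).mulVec f ≠ 0 := by
      by_contra! hc
      exact hne (eq_zero_of_dualIdempotent_mulVec hc)
    obtain ⟨t, h1, h2⟩ := h.exists_dualIdempotent (hU hf) i
    have ht : t ≠ 0 := by
      rintro rfl
      simp [h2] at hi
    have hi' : 1 ≤ i ∧ i < D := by
      by_contra hc
      exact ht (h1 hc)
    have h3 := hT _ (G.dualIdempotent_mem x i) _ hf
    rw [h2] at h3
    obtain ⟨i, rfl⟩ : ∃ n, i = n + 1 := ⟨i - 1, by omega⟩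
    exact h.one_mem hT hi'.2 ((U.smul_mem_iff ht).1 h3)

theorem dualComponent_zero (h : G.IsProperLadder x D up flat down w) :
    G.dualComponent x 0 (ladderSpan D w) = ⊥ := by
  rw [Submodule.eq_bot_iff]
  rintro _ ⟨f, hf, rfl⟩
  obtain ⟨t, -, h2⟩ := h.exists_dualIdempotent hf 0
  rw [Matrix.mulVecLin_apply, h2, h.zero, smul_zero]

theorem endpoint_eq (h : G.IsProperLadder x D up flat down w) :
    G.endpoint x (ladderSpan D w) = 1 := by
  have h1 : 1 ∈ {i : ℕ | G.dualComponent x i (ladderSpan D w) ≠ ⊥} := by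
    intro h0
    refine h.one_ne_zero ((Submodule.eq_bot_iff _).1 h0 _
      ⟨w 1, mem_ladderSpan w le_rfl h.one_lt, ?_⟩)
    rw [Matrix.mulVecLin_apply, h.dualIdempotent_mulVec, if_pos rfl]
  refine le_antisymm (Nat.sInf_le h1) (Nat.one_le_iff_ne_zero.2 fun h0 => ?_)
  have h2 := Nat.sInf_mem ⟨1, h1⟩
  rw [show sInf _ = 0 from h0] at h2
  exact h2 h.dualComponent_zero

theorem isThin (h : G.IsProperLadder x D up flat down w) : G.IsThin x (ladderSpan D w) := by
  intro i
  have h1 : G.dualComponent x i (ladderSpan D w) ≤ Submodule.span ℂ {w i} := by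
    rintro _ ⟨f, hf, rfl⟩
    obtain ⟨t, -, h2⟩ := h.exists_dualIdempotent hf i
    rw [Matrix.mulVecLin_apply, h2]
    exact Submodule.smul_mem _ t (Submodule.mem_span_singleton_self _)
  exact (Submodule.finrank_mono h1).trans ((finrank_span_le_card _).trans (by simp))

theorem hasLocalEigenvalue (h : G.IsProperLadder x D up flat down w) (hecc : G.vertexEcc x = D) :
    G.HasLocalEigenvalue x (ladderSpan D w) (flat 1) := by
  refine ⟨h.isThin, ?_⟩
  rw [h.endpoint_eq]
  rintro _ ⟨f, hf, rfl⟩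
  obtain ⟨t, -, h2⟩ := h.exists_dualIdempotent hf 1
  rw [Matrix.mulVecLin_apply, h2, Matrix.mulVec_smul,
    G.flat_mulVec (by have := h.one_lt; omega) (h.support 1),
    h.dualIdempotent_cAdj_flat (r := 0) h.one_lt, smul_comm]

/-- Both components on a sphere carry the same scalar, and the ladder vectors are nonzero. This
makes both projections of `ladderGraph` injective. -/
theorem snd_eq_zero (h : G.IsProperLadder x D up flat down w)
    (h' : G.IsProperLadder x D up flat down w') {q : (X → ℂ) × (X → ℂ)}
    (hq : q ∈ ladderGraph D w w') : q.1 = 0 ↔ q.2 = 0 := by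
  have hz : ∀ i, (G.dualIdempotent x i).mulVec q.1 = 0 ↔ (G.dualIdempotent x i).mulVec q.2 = 0 := by
    intro i
    obtain ⟨t, h1, h2, h3⟩ := h.exists_dualIdempotent_graph h'.toIsLadder hq i
    rw [h2, h3]
    by_cases hi : 1 ≤ i ∧ i < D
    · obtain ⟨i, rfl⟩ : ∃ n, i = n + 1 := ⟨i - 1, by omega⟩
      rw [smul_eq_zero, smul_eq_zero, or_iff_left (h.ne_zero hi.2), or_iff_left (h'.ne_zero hi.2)]
    · simp [h1 hi]
  constructor
  · intro h0
    exact eq_zero_of_dualIdempotent_mulVec fun i => (hz i).1 (by rw [h0, Matrix.mulVec_zero])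
  · intro h0
    exact eq_zero_of_dualIdempotent_mulVec fun i => (hz i).2 (by rw [h0, Matrix.mulVec_zero])

/-- Two ladders with the same coefficients span isomorphic modules. -/
theorem areTIsomorphic (h : G.IsProperLadder x D up flat down w)
    (h' : G.IsProperLadder x D up flat down w') :
    AreTIsomorphic (G.terwilligerAlgebra x) (ladderSpan D w) (ladderSpan D w') := by
  let e1 : ladderGraph D w w' ≃ₗ[ℂ] ladderSpan D w := LinearEquiv.ofBijective
    (((LinearMap.fst ℂ (X → ℂ) (X → ℂ)).comp (ladderGraph D w w').subtype).codRestrict _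
      fun q => fst_mem_of_mem_ladderGraph q.2) (by
        constructor
        · rw [← LinearMap.ker_eq_bot, LinearMap.ker_eq_bot']
          intro q hq
          have h1 : q.1.1 = 0 := congrArg Subtype.val hq
          exact Subtype.ext (Prod.ext h1 ((h.snd_eq_zero h' q.2).1 h1))
        · rintro ⟨f, hf⟩
          obtain ⟨g, hg⟩ := exists_mem_ladderGraph w' hf
          exact ⟨⟨(f, g), hg⟩, rfl⟩)
  let e2 : ladderGraph D w w' ≃ₗ[ℂ] ladderSpan D w' := LinearEquiv.ofBijective
    (((LinearMap.snd ℂ (X → ℂ) (X → ℂ)).comp (ladderGraph D w w').subtype).codRestrict _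
      fun q => snd_mem_of_mem_ladderGraph q.2) (by
        constructor
        · rw [← LinearMap.ker_eq_bot, LinearMap.ker_eq_bot']
          intro q hq
          have h1 : q.1.2 = 0 := congrArg Subtype.val hq
          exact Subtype.ext (Prod.ext ((h.snd_eq_zero h' q.2).2 h1) h1)
        · rintro ⟨g, hg⟩
          obtain ⟨f, hf⟩ := exists_mem_ladderGraph' w hg
          exact ⟨⟨(f, g), hf⟩, rfl⟩)
  refine ⟨e1.symm.trans e2, fun B hB f u hu => ?_⟩
  obtain ⟨q, rfl⟩ := e1.surjective f
  have hmem := h.graph_mem h'.toIsLadder hB q.1 q.2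
  have h3 : u = e1 ⟨_, hmem⟩ := Subtype.ext hu
  rw [h3]
  simp only [LinearEquiv.trans_apply, LinearEquiv.symm_apply_apply]
  rfl

end IsProperLadder

/-! ### The graph without flat edges -/

section flatFree

variable {G : SimpleGraph X} {x : X}

theorem exists_walk_flatFree (hc : G.Connected) (n : ℕ) :
    ∀ y, G.dist y x = n → ∃ q : (G.flatFree x).Walk y x, q.length = n := by
  induction n with
  | zero =>
    intro y hy
    obtain rfl := hc.dist_eq_zero_iff.1 hy
    exact ⟨Walk.nil, rfl⟩
  | succ n ih =>
    intro y hy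
    have hne : y ≠ x := by
      rintro rfl
      simp at hy
    obtain ⟨z, h1, h2⟩ := hc.exists_adj_dist_add_one hne
    obtain ⟨q, hq⟩ := ih z (by omega)
    have h3 : (G.flatFree x).Adj y z := ⟨h1, by
      rw [G.dist_comm, G.dist_comm (v := z)]
      omega⟩
    exact ⟨Walk.cons h3 q, by rw [Walk.length_cons, hq]⟩

/-- A geodesic to `x` changes sphere at every step, so it survives the deletion of flat edges. -/
theorem dist_flatFree (hc : G.Connected) (y : X) : (G.flatFree x).dist x y = G.dist x y := by
  obtain ⟨q, hq⟩ := exists_walk_flatFree hc _ y (G.dist_comm (u := y) (v := x))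
  rw [(G.flatFree x).dist_comm]
  refine le_antisymm ((dist_le q).trans hq.le) ?_
  rw [G.dist_comm]
  exact Reachable.dist_anti (fun _ _ h => h.1) q.reachable

theorem dualIdempotent_flatFree (hc : G.Connected) (i : ℕ) :
    (G.flatFree x).dualIdempotent x i = G.dualIdempotent x i := by
  simp only [dualIdempotent, dist_flatFree hc]

theorem vertexEcc_flatFree (hc : G.Connected) : (G.flatFree x).vertexEcc x = G.vertexEcc x := by
  simp only [vertexEcc, dist_flatFree hc]

theorem dualIdempotent_cAdj_flatFree {f : X → ℂ} {r i : ℕ}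
    (hf : ∀ y, G.dist x y ≠ r → f y = 0) (hi : i ≠ r) :
    (G.dualIdempotent x i).mulVec ((G.flatFree x).cAdj.mulVec f) =
      (G.dualIdempotent x i).mulVec (G.cAdj.mulVec f) := by
  ext y
  simp only [dualIdempotent_mulVec, cAdj_mulVec_apply]
  split_ifs with hy
  · refine Finset.sum_congr rfl fun z _ => ?_
    by_cases hz : G.dist x z = r
    · simp [flatFree, hy, hz, hi]
    · simp [hf z hz]
  · rfl

namespace IsLadder

variable {D : ℕ} {up flat down up' flat' down' : ℕ → ℝ} {w w' : ℕ → X → ℂ}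

theorem raising_flatFree (h : G.IsLadder x D up flat down w) (hc : G.Connected)
    (hecc : G.vertexEcc x = D) (h0 : up 0 = 0) {r : ℕ} (hr : r < D) :
    ((G.flatFree x).raising x).mulVec (w r) = (up r : ℂ) • w (r + 1) := by
  rcases r with _ | r
  · rw [h.zero, Matrix.mulVec_zero, h0]
    simp
  · rw [raising_mulVec _ (r := r + 1) (by rw [vertexEcc_flatFree hc]; omega)
      (fun y hy => h.support _ y (by rwa [dist_flatFree hc] at hy)), dualIdempotent_flatFree hc,
      dualIdempotent_cAdj_flatFree (h.support _) (by omega), h.dualIdempotent_cAdj_up hr]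

theorem lowering_flatFree (h : G.IsLadder x D up flat down w) (hc : G.Connected)
    (hecc : G.vertexEcc x = D) (hD : down D = 0) {r : ℕ} (hr : r + 1 ≤ D) :
    ((G.flatFree x).lowering x).mulVec (w (r + 1)) = (down (r + 1) : ℂ) • w r := by
  rcases hr.lt_or_eq with h1 | h1
  · rw [lowering_mulVec _ (r := r) (by rw [vertexEcc_flatFree hc]; omega)
      (fun y hy => h.support _ y (by rwa [dist_flatFree hc] at hy)), dualIdempotent_flatFree hc,
      dualIdempotent_cAdj_flatFree (h.support _) (by omega), h.dualIdempotent_cAdj_down h1]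
  · rw [h1, h.top, hD]
    simp

end IsLadder

/-! ### Obstructions from the raising-lowering products -/

namespace IsProperLadder

variable {D : ℕ} {up flat down up' flat' down' : ℕ → ℝ} {w w' : ℕ → X → ℂ}

/-- The relation that a uniform structure imposes on the coefficients of a ladder. -/
theorem uniform_relation (h : G.IsProperLadder x D up flat down w) (hc : G.Connected)
    (hecc : G.vertexEcc x = D) (h0 : up 0 = 0) (hD : down D = 0) {U : ℕ → ℕ → ℂ} {f : ℕ → ℂ}
    (hU : (G.flatFree x).IsUniformStructure x U f) {j : ℕ} (hj : j + 2 < D) :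
    U (j + 2) (j + 1) * (up j * down (j + 1)) + up (j + 1) * down (j + 2) +
      U (j + 2) (j + 3) * (up (j + 2) * down (j + 3)) = f (j + 2) := by
  have hecc' : (G.flatFree x).vertexEcc x = D := by rw [vertexEcc_flatFree hc, hecc]
  have h1 := congrArg (fun M => M.mulVec (w (j + 2)))
    (hU.2 (j + 2) (by rw [hecc', Finset.mem_Icc]; omega))
  have hL := fun r (hr : r + 1 ≤ D) => h.lowering_flatFree hc hecc hD (r := r) hr
  have hR := fun r (hr : r < D) => h.raising_flatFree hc hecc h0 (r := r) hr
  -- All three words send `w (j + 2)` to multiples of `w (j + 1)`. As 2 ≤ j + 2 < D, `eMinus` and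
  -- `ePlus` are genuine entries of `U`.
  simp only [← Matrix.mulVec_mulVec, dualIdempotent_flatFree hc, h.dualIdempotent_mulVec, if_true,
    Matrix.add_mulVec, Matrix.smul_mulVec, pow_two, hL (j + 1) (by omega), hL j (by omega),
    hR j (by omega), hR (j + 1) (by omega), hR (j + 2) (by omega), hL (j + 2) (by omega),
    Matrix.mulVec_smul] at h1
  have h2 : ((down (j + 2) : ℝ) : ℂ) ≠ 0 := by exact_mod_cast h.down_ne_zero j hj
  have e1 : eMinus U (j + 2) = U (j + 2) (j + 1) := by simp [eMinus]
  have e2 : ePlus D U (j + 2) = U (j + 2) (j + 3) := by simp [ePlus, hj]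
  rw [hecc', e1, e2] at h1
  have h3 : ((down (j + 2) : ℂ) * (U (j + 2) (j + 1) * (up j * down (j + 1)) +
      up (j + 1) * down (j + 2) + U (j + 2) (j + 3) * (up (j + 2) * down (j + 3)) - f (j + 2))) •
        w (j + 1) = 0 := by
    linear_combination (norm := module) h1
  have h4 := (smul_eq_zero.1 h3).resolve_right (h.ne_zero (by omega))
  exact sub_eq_zero.1 ((mul_eq_zero.1 h4).resolve_left h2)

end IsProperLadder

/-- A tridiagonal parameter matrix annihilates no nonzero sequence on `{2, …, D - 1}`. -/
theorem IsParameterMatrix.eq_zero {D : ℕ} (hD : 3 ≤ D) {U : ℕ → ℕ → ℂ}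
    (hU : IsParameterMatrix D U) {φ : ℕ → ℂ} (h1 : φ 1 = 0) (hφD : φ D = 0)
    (h : ∀ j, j + 2 < D → U (j + 2) (j + 1) * φ (j + 1) + φ (j + 2) +
      U (j + 2) (j + 3) * φ (j + 3) = 0) : φ 2 = 0 := by
  -- The relations are available only for rows 2, ..., D - 1. The omitted columns 1 and D do not
  -- matter because φ vanishes there.
  have hdet := hU.nonsingular 2 (D - 1) (by omega) (by omega) (by omega)
  have hz : (Matrix.of fun i j : Finset.Icc 2 (D - 1) => U i j).mulVec
      (fun j : Finset.Icc 2 (D - 1) => φ j) = 0 := by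
    ext ⟨i, hi⟩
    rw [Finset.mem_Icc] at hi
    obtain ⟨j, rfl⟩ : ∃ j, i = j + 2 := ⟨i - 2, by omega⟩
    simp only [Matrix.mulVec, dotProduct, Matrix.of_apply, Pi.zero_apply]
    rw [Finset.sum_coe_sort (Finset.Icc 2 (D - 1)) (fun k => U (j + 2) k * φ k)]
    rw [Finset.sum_subset (s₂ := Finset.Icc 1 D)
      (fun k hk => by simp only [Finset.mem_Icc] at hk ⊢; omega)]
    · rw [← Finset.sum_subset (s₁ := {j + 1, j + 2, j + 3})
        (fun k hk => by simp only [Finset.mem_insert, Finset.mem_singleton] at hk; simp; omega)]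
      · rw [Finset.sum_insert (by simp), Finset.sum_insert (by simp), Finset.sum_singleton,
          hU.diagonal (j + 2) (by simp; omega), ← h j (by omega)]
        ring
      · intro k hk hk'
        rw [hU.tridiagonal (j + 2) (by simp; omega) k hk, zero_mul]
        simp only [Finset.mem_insert, Finset.mem_singleton] at hk'
        omega
    · intro k hk hk'
      simp only [Finset.mem_Icc] at hk hk'
      rcases (by omega : k = 1 ∨ k = D) with rfl | rfl
      · rw [h1, mul_zero]
      · rw [hφD, mul_zero]
  have h0 := Matrix.eq_zero_of_mulVec_eq_zero hdet hz
  exact congrFun h0 ⟨2, by rw [Finset.mem_Icc]; omega⟩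

namespace IsProperLadder

variable {D : ℕ} {up flat down up' flat' down' : ℕ → ℝ} {w w' : ℕ → X → ℂ}

theorem coeff_eq_of_uniform (h : G.IsProperLadder x D up flat down w)
    (h' : G.IsProperLadder x D up' flat' down' w') (hc : G.Connected)
    (hecc : G.vertexEcc x = D) (hD3 : 3 ≤ D) (h0 : up 0 = 0) (hD : down D = 0) (h0' : up' 0 = 0)
    (hD' : down' D = 0) (hU : G.SupportsUniformStructure x) :
    up 1 * down 2 = up' 1 * down' 2 := by
  obtain ⟨U, f, hU⟩ := hU
  have hP := hU.1
  rw [vertexEcc_flatFree hc, hecc] at hP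
  have := hP.eq_zero hD3
    -- Subtracting the relations of the two ladders removes the common `f`; the boundary values
    -- vanish through `up 0 = 0` and `down D = 0`.
    (φ := fun r => ((up (r - 1) * down r - up' (r - 1) * down' r : ℝ) : ℂ))
    (by simp [h0, h0']) (by simp [hD, hD']) (by
      intro j hj
      have e1 := h.uniform_relation hc hecc h0 hD hU hj
      have e2 := h'.uniform_relation hc hecc h0' hD' hU hj
      simp only [Nat.add_sub_cancel, show j + 2 - 1 = j + 1 by omega,
        show j + 3 - 1 = j + 2 by omega]
      push_cast
      linear_combination e1 - e2)
  have h2 : up 1 * down 2 - up' 1 * down' 2 = 0 := by exact_mod_cast this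
  linarith

theorem coeff_eq_of_areTIsomorphic (h : G.IsProperLadder x D up flat down w)
    (h' : G.IsProperLadder x D up' flat' down' w') (hc : G.Connected) (hD3 : 3 ≤ D)
    (hiso : AreTIsomorphic ((G.flatFree x).terwilligerAlgebra x) (ladderSpan D w)
      (ladderSpan D w')) : up 1 * down 2 = up' 1 * down' 2 := by
  obtain ⟨σ, hσ⟩ := hiso
  set H := G.flatFree x with hH
  have hE : ∀ i, G.dualIdempotent x i ∈ H.terwilligerAlgebra x := by
    intro i
    rw [← dualIdempotent_flatFree hc]
    exact H.dualIdempotent_mem x i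
  -- Raising to the second sphere and lowering back acts on `w 1` as the scalar `up 1 * down 2`, an
  -- invariant of the `T_f`-module.
  set B := G.dualIdempotent x 1 * (H.cAdj * (G.dualIdempotent x 2 * H.cAdj)) with hB
  have hBmem : B ∈ H.terwilligerAlgebra x :=
    mul_mem (hE 1) (mul_mem (H.cAdj_mem x) (mul_mem (hE 2) (H.cAdj_mem x)))
  have hBw : ∀ {up flat down : ℕ → ℝ} {w : ℕ → X → ℂ}, G.IsLadder x D up flat down w →
      B.mulVec (w 1) = ((up 1 * down 2 : ℝ) : ℂ) • w 1 := by
    intro up flat down w h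
    rw [hB]
    simp only [← Matrix.mulVec_mulVec]
    rw [dualIdempotent_cAdj_flatFree (h.support 1) (by omega),
      h.dualIdempotent_cAdj_up (r := 0) (by omega), Matrix.mulVec_smul, Matrix.mulVec_smul,
      dualIdempotent_cAdj_flatFree (h.support 2) (by omega),
      h.dualIdempotent_cAdj_down (r := 1) (by omega), smul_smul]
    push_cast
    rfl
  let v : ladderSpan D w := ⟨w 1, mem_ladderSpan w le_rfl h.one_lt⟩
  have h1 : (σ v : X → ℂ) = (G.dualIdempotent x 1).mulVec (σ v : X → ℂ) :=
    hσ _ (hE 1) v v (by simp [v, h.dualIdempotent_mulVec])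
  obtain ⟨t, -, h2⟩ := h'.exists_dualIdempotent (σ v).2 1
  rw [h2] at h1
  have h3 := hσ B hBmem v (((up 1 * down 2 : ℝ) : ℂ) • v) (hBw h.toIsLadder).symm
  rw [map_smul, Submodule.coe_smul, h1, Matrix.mulVec_smul, hBw h'.toIsLadder, smul_comm t,
    ← sub_eq_zero, ← sub_smul] at h3
  have h4 : t • w' 1 ≠ 0 := by
    rw [← h1]
    intro h5
    have h6 : σ v = 0 := Subtype.ext h5
    rw [map_eq_zero_iff σ σ.injective] at h6
    exact h.one_ne_zero (congrArg Subtype.val h6)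
  have h5 := (smul_eq_zero.1 h3).resolve_right h4
  exact_mod_cast sub_eq_zero.1 h5

end IsProperLadder

end flatFree

/-! ### The modules of endpoint one -/

theorem IsTModule.localShift_mem {G : SimpleGraph X} {x : X} {W : Submodule ℂ (X → ℂ)}
    (hW : IsTModule (G.terwilligerAlgebra x) W) (η : ℝ) {v : X → ℂ} (hv : v ∈ W) :
    G.localShift x η v ∈ W :=
  sub_mem (hW _ (G.dualIdempotent_mem x 1) _ (hW _ (G.cAdj_mem x) _ hv)) (W.smul_mem _ hv)

/-- For `v` on the first sphere, the entry of A v at `x` is the sum of `v`; it vanishes because the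
module has no component at `x`. -/
theorem IsTModule.exists_isLocalVector {G : SimpleGraph X} {x : X} {W : Submodule ℂ (X → ℂ)}
    (hW : IsTModule (G.terwilligerAlgebra x) W) (h1 : G.endpoint x W = 1) :
    ∃ v ∈ W, v ≠ 0 ∧ G.IsLocalVector x v := by
  -- The infimum of the empty set is 0, so endpoint 1 rules out the empty case.
  have hne : {i : ℕ | G.dualComponent x i W ≠ ⊥}.Nonempty := by
    by_contra h
    rw [Set.not_nonempty_iff_eq_empty] at h
    rw [endpoint, h, Nat.sInf_empty] at h1
    omega
  have h2 : G.dualComponent x 1 W ≠ ⊥ := by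
    have := Nat.sInf_mem hne
    rwa [show sInf _ = 1 from h1] at this
  have h3 : G.dualComponent x 0 W = ⊥ := by
    by_contra h
    have : G.endpoint x W ≤ 0 := Nat.sInf_le h
    omega
  obtain ⟨v, hv, hv0⟩ := (Submodule.ne_bot_iff _).1 h2
  obtain ⟨f, hf, rfl⟩ := hv
  rw [Matrix.mulVecLin_apply] at hv0
  set v := (G.dualIdempotent x 1).mulVec f with hvdef
  have hvW : v ∈ W := hW _ (G.dualIdempotent_mem x 1) _ hf
  have hsupp : ∀ y, G.dist x y ≠ 1 → v y = 0 := by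
    intro y hy
    rw [hvdef, dualIdempotent_mulVec, if_neg hy]
  refine ⟨v, hvW, hv0, hsupp, ?_⟩
  have h4 := (Submodule.eq_bot_iff _).1 h3 _ ⟨_, hW _ (G.cAdj_mem x) _ hvW, rfl⟩
  have h5 := congrFun h4 x
  rw [Matrix.mulVecLin_apply, dualIdempotent_mulVec, if_pos dist_self, cAdj_mulVec_apply] at h5
  rw [Pi.zero_apply] at h5
  rw [← h5]
  refine Finset.sum_congr rfl fun y _ => ?_
  split_ifs with hy
  · rfl
  · exact hsupp y fun h => hy (dist_eq_one_iff_adj.1 h)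

namespace HasUnitBaseArray

variable {G : SimpleGraph X} {D : ℕ} {α : ℝ} {c a b : ℕ → ℕ} {x : X} {v : X → ℂ}

theorem isProperLadder_second (h : G.HasUnitBaseArray D α (1 + α * (D - 1)) c a b)
    (hv : G.IsLocalVector x v) (hv0 : v ≠ 0) (hu : (G.cDistMatrix (linSeq D)).mulVec v = 0) :
    G.IsProperLadder x D (upSecond α) (flatSecond D α) (downSecond D α)
      (G.ladderVec x (fun _ => 1) v) where
  toIsLadder := h.isLadder_second hv hu
  one_lt := by have := h.three_le; omega
  one_ne_zero := by rwa [hv.ladderVec_one h.counts.connected rfl]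
  up_ne_zero r _ := by
    have := h.one_add_pos r
    simp only [upSecond]
    push_cast
    rw [add_sub_cancel_right]
    positivity
  down_ne_zero r hr := by
    have h1 := h.pos_of_lt hr
    have h2 : (0 : ℝ) < D - (r + 2 : ℕ) := sub_pos.2 (by exact_mod_cast hr)
    exact (mul_pos h2 h1).ne'

theorem isProperLadder_least (h : G.HasUnitBaseArray D α (1 + α * (D - 1)) c a b)
    (hv : G.IsLocalVector x v) (hv0 : v ≠ 0)
    (hu : (G.cDistMatrix (leastSeq α (1 + α * (D - 1)))).mulVec v = 0) :
    G.IsProperLadder x D (upLeast α) (flatLeast D α) (downLeast D α)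
      (G.ladderVec x (fun r => 1 + α * (r - 1)) v) where
  toIsLadder := h.isLadder_least hv hu
  one_lt := by have := h.three_le; omega
  one_ne_zero := by rwa [hv.ladderVec_one h.counts.connected (by simp)]
  up_ne_zero r _ := by
    have := h.one_add_pos (r + 1)
    simp only [upLeast]
    positivity
  down_ne_zero r hr := by
    have h0 := h.alpha_nonneg
    have h2 : (0 : ℝ) < D - (r + 2 : ℕ) := sub_pos.2 (by exact_mod_cast hr)
    simp only [downLeast]
    positivity

theorem coeff_ne (h : G.HasUnitBaseArray D α (1 + α * (D - 1)) c a b) (hα : 0 < α) :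
    upSecond α 1 * downSecond D α 2 ≠ upLeast α 1 * downLeast D α 2 := by
  have h2 : (2 : ℝ) < D := by exact_mod_cast h.three_le
  have h3 : 0 < α * (D - 2) * (2 + α * (D - 2)) := by
    have : (0 : ℝ) < D - 2 := by linarith
    positivity
  intro he
  simp only [upSecond, downSecond, upLeast, downLeast] at he
  push_cast at he
  linarith

/-- Take the difference of the indicators of two neighbours `y`, `z` of `x`. The entry at `y` of its
shift is -1 - η or -η, according to whether they are adjacent. This one vector starts ladders of
both kinds. -/
theorem exists_isLocalVector (h : G.HasUnitBaseArray D α (1 + α * (D - 1)) c a b) (x : X) :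
    ∃ v, G.IsLocalVector x v ∧ ∀ η : ℝ, η ≠ 0 → η ≠ -1 → G.localShift x η v ≠ 0 := by
  have hb : 1 < (G.neighborFinset x).card := by
    rw [h.counts.card_neighborFinset_eq]
    have h1 := h.b_eq 0 (by omega)
    have h3 : (3 : ℝ) ≤ D := by exact_mod_cast h.three_le
    have h4 := h.pos_of_lt (i := 0) (by have := h.three_le; omega)
    have h5 := mul_nonneg h.alpha_nonneg (by linarith : (0 : ℝ) ≤ D - 1)
    have h6 : (1 : ℝ) < b 0 := by
      rw [h1]
      push_cast
      nlinarith
    exact_mod_cast h6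
  obtain ⟨y, hy, z, hz, hyz⟩ := Finset.one_lt_card.1 hb
  rw [mem_neighborFinset] at hy hz
  have hy1 := dist_eq_one_iff_adj.2 hy
  have hz1 := dist_eq_one_iff_adj.2 hz
  refine ⟨Pi.single y 1 - Pi.single z 1, ⟨?_, ?_⟩, ?_⟩
  · intro t ht
    have h1 : t ≠ y := by
      rintro rfl
      exact ht hy1
    have h2 : t ≠ z := by
      rintro rfl
      exact ht hz1
    simp [h1, h2]
  · simp [Finset.sum_sub_distrib]
  · intro η h0 h1 he
    have h2 := congrFun he y
    rw [localShift, Pi.sub_apply, dualIdempotent_mulVec, if_pos hy1, Matrix.mulVec_sub] at h2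
    simp only [Matrix.mulVec_single_one, Pi.sub_apply, Matrix.col_apply, cAdj, adjMatrix_apply,
      SimpleGraph.irrefl, if_false, Pi.smul_apply, Pi.single_eq_same, Pi.single_eq_of_ne hyz,
      sub_zero, smul_eq_mul, mul_one, Pi.zero_apply] at h2
    by_cases hadj : G.Adj y z
    · rw [if_pos hadj] at h2
      apply h1
      have : (η : ℂ) = ((-1 : ℝ) : ℂ) := by
        push_cast
        linear_combination -h2
      exact_mod_cast this
    · rw [if_neg hadj] at h2
      apply h0
      have : (η : ℂ) = ((0 : ℝ) : ℂ) := by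
        push_cast
        linear_combination -h2
      exact_mod_cast this

/-- The modules of endpoint one of a tight graph with classical parameters `(D, 1, α, β)`. -/
theorem exists_endpoint_one_modules (h : G.HasUnitBaseArray D α (1 + α * (D - 1)) c a b)
    (hα : 0 < α) (x : X) :
    ¬ G.SupportsUniformStructure x ∧
    ∃ W₁ W_D : Submodule ℂ (X → ℂ),
      (IsIrreducibleTModule (G.terwilligerAlgebra x) W₁ ∧ G.endpoint x W₁ = 1 ∧
        G.HasLocalEigenvalue x W₁ (-2)) ∧
      (IsIrreducibleTModule (G.terwilligerAlgebra x) W_D ∧ G.endpoint x W_D = 1 ∧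
        G.HasLocalEigenvalue x W_D (α * (D - 2))) ∧
      (∀ W : Submodule ℂ (X → ℂ),
        IsIrreducibleTModule (G.terwilligerAlgebra x) W → G.endpoint x W = 1 →
          AreTIsomorphic (G.terwilligerAlgebra x) W W₁ ∨
          AreTIsomorphic (G.terwilligerAlgebra x) W W_D) ∧
      ¬ AreTIsomorphic ((G.flatFree x).terwilligerAlgebra x) W₁ W_D := by
  have hc := h.counts.connected
  have hecc : G.vertexEcc x = D := by rw [h.counts.vertexEcc_eq, h.diam_eq]
  have hD : (0 : ℝ) < D - 2 := sub_pos.2 (by exact_mod_cast h.three_le)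
  have hτ : 0 < α * (D - 2) := by positivity
  obtain ⟨v, hv, hshift⟩ := h.exists_isLocalVector x
  have hl₁ := h.isProperLadder_second (hv.localShift h.counts (α * (D - 2)))
    (hshift _ hτ.ne' (by linarith)) (h.linSeq_mulVec_localShift hv)
  have hl_D := h.isProperLadder_least (hv.localShift h.counts (-2))
    (hshift _ (by norm_num) (by norm_num)) (h.leastSeq_mulVec_localShift hv)
  have h1 : flatSecond D α 1 = -2 := by
    simp [flatSecond]
  have h2 : flatLeast D α 1 = α * (D - 2) := by
    simp only [flatLeast]
    push_cast
    ring
  refine ⟨fun hU => h.coeff_ne hα (hl₁.coeff_eq_of_uniform hl_D hc hecc h.three_le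
    (by simp [upSecond]) (by simp [downSecond]) (by simp [upLeast]) (by simp [downLeast]) hU),
    _, _, ⟨hl₁.isIrreducibleTModule, hl₁.endpoint_eq, h1 ▸ hl₁.hasLocalEigenvalue hecc⟩,
    ⟨hl_D.isIrreducibleTModule, hl_D.endpoint_eq, h2 ▸ hl_D.hasLocalEigenvalue hecc⟩,
    fun W hW hend => ?_, fun hiso => h.coeff_ne hα
      (hl₁.coeff_eq_of_areTIsomorphic hl_D hc h.three_le hiso)⟩
  obtain ⟨u, huW, hu0, hu⟩ := hW.1.exists_isLocalVector hend
  -- The two shifts of `u` differ by (α(D - 2) + 2)u, so they cannot both vanish; a nonzero one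
  -- starts a ladder inside `W`, which irreducibility makes all of `W`.
  by_cases hs : G.localShift x (-2) u = 0
  · left
    have hne : G.localShift x (α * (D - 2)) u ≠ 0 := by
      intro h0
      have h3 : ((α * (D - 2) + 2 : ℝ) : ℂ) • u = 0 := by
        rw [← sub_self (0 : X → ℂ)]
        nth_rw 1 [← hs]
        rw [← h0, localShift, localShift]
        push_cast
        module
      refine hu0 ((smul_eq_zero.1 h3).resolve_left ?_)
      exact_mod_cast (by linarith : (0 : ℝ) < α * (D - 2) + 2).ne'
    have hl := h.isProperLadder_second (hu.localShift h.counts (α * (D - 2))) hne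
      (h.linSeq_mulVec_localShift hu)
    have hle := hl.ladderSpan_le hW.1 (by
      rw [(hu.localShift h.counts _).ladderVec_one hc rfl]
      exact hW.1.localShift_mem _ huW)
    rw [← (hW.2.2 _ hle hl.isTModule).resolve_left hl.ladderSpan_ne_bot]
    exact hl.areTIsomorphic hl₁
  · right
    have hl := h.isProperLadder_least (hu.localShift h.counts (-2)) hs
      (h.leastSeq_mulVec_localShift hu)
    have hle := hl.ladderSpan_le hW.1 (by
      rw [(hu.localShift h.counts _).ladderVec_one hc (by simp)]
      exact hW.1.localShift_mem _ huW)
    rw [← (hW.2.2 _ hle hl.isTModule).resolve_left hl.ladderSpan_ne_bot]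
    exact hl.areTIsomorphic hl_D

end HasUnitBaseArray

end SimpleGraph

/-! ### The main theorem: evaluation of the local eigenvalues -/

theorem theorem9p2 {X : Type*} [Fintype X] [DecidableEq X] (G : SimpleGraph X)
    (p : ℕ → ℕ → ℕ → ℕ) (hG : G.IsDistanceRegularWith p) (hbip : ¬ G.IsBipartite)
    (D : ℕ) (hD : 3 ≤ D) (α β : ℝ) (hcl : G.HasClassicalParameters p D 1 α β)
    (htight : G.IsTight p) (x : X) :
    ¬ G.SupportsUniformStructure x ∧
    ∃ W₁ W_D : Submodule ℂ (X → ℂ),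
      (SimpleGraph.IsIrreducibleTModule (G.terwilligerAlgebra x) W₁ ∧ G.endpoint x W₁ = 1 ∧
        G.HasLocalEigenvalue x W₁ (SimpleGraph.tildeValue p G.secondEigenvalue)) ∧
      (SimpleGraph.IsIrreducibleTModule (G.terwilligerAlgebra x) W_D ∧ G.endpoint x W_D = 1 ∧
        G.HasLocalEigenvalue x W_D (SimpleGraph.tildeValue p G.leastEigenvalue)) ∧
      (∀ W : Submodule ℂ (X → ℂ),
        SimpleGraph.IsIrreducibleTModule (G.terwilligerAlgebra x) W → G.endpoint x W = 1 →
          SimpleGraph.AreTIsomorphic (G.terwilligerAlgebra x) W W₁ ∨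
          SimpleGraph.AreTIsomorphic (G.terwilligerAlgebra x) W W_D) ∧
      ¬ SimpleGraph.AreTIsomorphic ((G.flatFree x).terwilligerAlgebra x) W₁ W_D := by
  have h := hG.hasUnitBaseArray hD hcl
  have hdiam := h.diam_eq
  have hβ := h.beta_eq_of_tight (by
    simpa only [SimpleGraph.IsTight, show (0 < G.diam) by omega, show (1 < G.diam) by omega,
      if_true] using htight)
  have hα := h.alpha_pos_of_not_isBipartite hβ hbip
  subst hβ
  have hD3 : (3 : ℝ) ≤ D := by exact_mod_cast hD
  have hb1 := h.b_eq 1 (by omega)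
  simp only [show (1 < G.diam) by omega, if_true] at hb1
  have hpos := h.pos_of_lt (i := 1) (by omega)
  push_cast at hb1 hpos
  -- At the tight value of β, 1 + θ_1 equals b_1 = (D - 1)(1 + α(D - 2)).
  have h1 : SimpleGraph.tildeValue p G.secondEigenvalue = -2 := by
    have hne : ((D : ℝ) - 1) * (1 + α * (D - 1) - α * 1) ≠ 0 :=
      mul_ne_zero (by linarith) (by nlinarith)
    rw [SimpleGraph.tildeValue, hb1, h.secondEigenvalue_eq, SimpleGraph.HasUnitBaseArray.theta,
      Nat.cast_one, add_sub_cancel, div_self hne]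
    norm_num
  -- Here 1 + θ_D = -(D - 1) cancels the factor D - 1 of b_1.
  have h2 : SimpleGraph.tildeValue p G.leastEigenvalue = α * (D - 2) := by
    have hne : (1 : ℝ) + -D ≠ 0 := by linarith
    rw [SimpleGraph.tildeValue, hb1, h.leastEigenvalue_eq, sub_eq_iff_eq_add,
      ← sub_eq_iff_eq_add', eq_div_iff hne]
    ring
  rw [h1, h2]
  exact h.exists_endpoint_one_modules hα x
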